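/- Let $B$ be a unital complex algebra and let $\mathbb{C}\subset^{\varphi_0}B=A_0\subset^{\varphi_1}A_1\subset^{\varphi_2}A_2\subset^{\varphi_3}\cdots$ be a tower of amalgamated noncommutative probability spaces: each $A_n$ is a unital subalgebra of $A_{n+1}$ (with the same unit), $\varphi_0:B\to\mathbb{C}$ is a linear functional, and for each $n\ge 1$ the map $\varphi_n:A_n\to A_{n-1}$ is a conditional expectation, i.e. linear with $\varphi_n(b)=b$ and $\varphi_n(bab')=b\,\varphi_n(a)\,b'$ for $b,b'\in A_{n-1}$, $a\in A_n$. Put $E_n=\varphi_0\varphi_1\cdots\varphi_n:A_n\to\mathbb{C}$, let $A_\infty=\bigcup_n A_n$, and let $E_\infty:A_\infty\to\mathbb{C}$ be the linear functional with $E_\infty(a)=E_n(a)$ for $a\in A_n$. For a linear functional $E$ on a unital algebra $A$, the cumulants are $$k_n^{(E)}(a_1,\dots,a_n)=\sum_{\pi\in NC(n)}\Big(\prod_{V=(v_1<\dots<v_m)\in\pi}E(a_{v_1}\cdots a_{v_m})\Big)\,\mu(\pi,1_n),$$ where $\mu$ is the Möbius function of the lattice $NC(n)$ of noncrossing partitions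 of $\{1,\dots,n\}$ and $1_n$ is its largest element. The R-transform of $a_1,\dots,a_s\in A$ is the formal series $$r^{(E)}_{a_1,\dots,a_s}(z_1,\dots,z_s)=\sum_{n\ge1}\ \sum_{i_1,\dots,i_n=1}^{s}k^{(E)}_n(a_{i_1},\dots,a_{i_n})\,z_{i_1}\cdots z_{i_n}$$ in noncommuting indeterminates. Two subsets $X_1,X_2\subset A$ are free in $(A,E)$ if, with $\mathcal{A}_i$ the unital subalgebra generated by $X_i$, all mixed cumulants vanish: $k_n^{(E)}(a_1,\dots,a_n)=0$ whenever $a_j\in\mathcal{A}_{i(j)}$ for all $j$ and $i(1),\dots,i(n)\in\{1,2\}$ are not all equal. The boxed convolution of Nica and Speicher of two such series $f=\sum_{n}\sum f_{i_1,\dots,i_n}z_{i_1}\cdots z_{i_n}$ and $g=\sum_{n}\sum g_{i_1,\dots,i_n}z_{i_1}\cdots z_{i_n}$ is the series $f\boxast g$ whose $(i_1,\dots,i_n)$-th coefficient is $$\sum_{\pi\in NC(n)}\Big(\prod_{V=(v_1<\dots<v_m)\in\pi}f_{i_{v_1},\dots,i_{v_m}}\Big)\Big(\prod_{W=(w_1<\dots<w_p)\in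 Kr(\pi)}g_{i_{w_1},\dots,i_{w_p}}\Big),$$ where the Kreweras complement $Kr(\pi)$ is the largest $\sigma\in NC(n)$, placed on points $\bar1,\dots,\bar n$, such that $\pi\cup\sigma$ is a noncrossing partition of $1<\bar1<2<\bar2<\dots<n<\bar n$. **Theorem.** Let $k<l$, let $x_1,\dots,x_s\in\bigcup_{j=1}^{k}A_j$ and $y_1,\dots,y_s\in\bigcup_{j=k+1}^{l}A_j$, and suppose that $X=\{x_1,\dots,x_s\}$ and $Y=\{y_1,\dots,y_s\}$ are free in $(A_l,E_l)$. Then in $(A_\infty,E_\infty)$ (a) $r^{(E_\infty)}_{x_1,\dots,x_s,y_1,\dots,y_s}(z_1,\dots,z_{2s})=r^{(E_\infty)}_{x_1,\dots,x_s}(z_1,\dots,z_s)+r^{(E_\infty)}_{y_1,\dots,y_s}(z_{s+1},\dots,z_{2s})$, (b) $r^{(E_\infty)}_{x_1+y_1,\dots,x_s+y_s}=r^{(E_\infty)}_{x_1,\dots,x_s}+r^{(E_\infty)}_{y_1,\dots,y_s}$, (c) $r^{(E_\infty)}_{x_1y_1,\dots,x_sy_s}=r^{(E_\infty)}_{x_1,\dots,x_s}\boxast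 r^{(E_\infty)}_{y_1,\dots,y_s}$, and, more precisely, (1) $r^{(E_\infty)}_{x_1,\dots,x_s,y_1,\dots,y_s}(z_1,\dots,z_{2s})=r^{(E_k)}_{x_1,\dots,x_s}(z_1,\dots,z_s)+r^{(E_l)}_{y_1,\dots,y_s}(z_{s+1},\dots,z_{2s})$, (2) $r^{(E_\infty)}_{x_1+y_1,\dots,x_s+y_s}=r^{(E_k)}_{x_1,\dots,x_s}+r^{(E_l)}_{y_1,\dots,y_s}$, (3) $r^{(E_\infty)}_{x_1y_1,\dots,x_sy_s}=r^{(E_k)}_{x_1,\dots,x_s}\boxast r^{(E_l)}_{y_1,\dots,y_s}$. -/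

import Mathlib

noncomputable section

/-! ### Noncrossing partitions -/

/-- A relation on a linearly ordered set (thought of as "lying in the same block") is noncrossing
if there are no `a < b < c < d` with `a, c` in one block and `b, d` in a different one. -/
def IsNoncrossing {α : Type*} [LinearOrder α] (r : α → α → Prop) : Prop :=
  ∀ a b c d : α, a < b → b < c → c < d → r a c → r b d → r a b

/-- `NC n`: the noncrossing partitions of the `n` points `0 < 1 < ⋯ < n - 1`, ordered by
refinement (`θ ≤ π` if every block of `θ` is contained in a block of `π`). -/
abbrev NC (n : ℕ) : Type :=
  {π : Finpartition (Finset.univ : Finset (Fin n)) //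
    IsNoncrossing fun i j : Fin n => π.part i = π.part j}

open Classical in
instance NC.instFintype (n : ℕ) : Fintype (NC n) := Subtype.fintype _

open Classical in
instance NC.instLocallyFiniteOrder (n : ℕ) : LocallyFiniteOrder (NC n) :=
  Fintype.toLocallyFiniteOrder

theorem part_top_eq {n : ℕ} (i j : Fin n) :
    (⊤ : Finpartition (Finset.univ : Finset (Fin n))).part i =
      (⊤ : Finpartition (Finset.univ : Finset (Fin n))).part j := by
  have h : ∀ k : Fin n, (⊤ : Finpartition (Finset.univ : Finset (Fin n))).part k =
      Finset.univ := fun k => by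
    have h1 := Finpartition.parts_top_subset (Finset.univ : Finset (Fin n))
      ((Finpartition.part_mem (P := ⊤)).2 (Finset.mem_univ k))
    simpa using h1
  rw [h i, h j]

/-- The largest element `1_n` of `NC n`, the partition with a single block. -/
def NC.one (n : ℕ) : NC n := ⟨⊤, fun _ _ _ _ _ _ _ _ _ => part_top_eq _ _⟩

open Classical in
/-- The value `μ(π, 1_n)` of the Möbius function of the lattice `NC n`. -/
def NC.moebius {n : ℕ} (π : NC n) : ℂ := IncidenceAlgebra.mu ℂ π (NC.one n)

/-- The multiplicative extension of a family `f` of functions of words: the product over the blocks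
`V = (v_1 < ⋯ < v_m)` of `π` of the numbers `f (a_{v_1}, …, a_{v_m})`. -/
def blockProd {α : Type*} (f : (m : ℕ) → (Fin m → α) → ℂ) {n : ℕ}
    (π : NC n) (a : Fin n → α) : ℂ :=
  ∏ V ∈ π.1.parts, f V.card (a ∘ V.orderEmbOfFin rfl)

/-! ### The Kreweras complement

Place points `0̄, 1̄, …` so that `0 < 0̄ < 1 < 1̄ < ⋯`.  The points strictly between `ī` and `j̄` that
carry no bar are those of `Set.uIoc i j`. -/

/-- `ī` and `j̄` are related if no block of `π` meets both the set of points between `ī` and `j̄` and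
the complement of that set. -/
def krewerasSetoid {n : ℕ} (π : NC n) : Setoid (Fin n) where
  r i j := ∀ p q : Fin n, π.1.part p = π.1.part q → (p ∈ Set.uIoc i j ↔ q ∈ Set.uIoc i j)
  iseqv :=
    { refl := fun i p q _ => by simp
      symm := fun {i j} h p q hpq => by
        rw [Set.uIoc_comm]
        exact h p q hpq
      trans := fun {i j k} h1 h2 p q hpq => by
        have h1 := h1 p q hpq
        have h2 := h2 p q hpq
        simp only [Set.mem_uIoc, ← not_lt] at h1 h2 ⊢
        grind }

open Classical in
theorem part_ofSetoid_eq_iff {n : ℕ} (r : Setoid (Fin n)) (i j : Fin n) :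
    (Finpartition.ofSetoid r).part i = (Finpartition.ofSetoid r).part j ↔ r i j := by
  rw [← Finpartition.mem_part_iff_part_eq_part _ (Finset.mem_univ i) (Finset.mem_univ j),
    Finpartition.mem_part_ofSetoid_iff_rel]
  exact ⟨fun h => r.symm h, fun h => r.symm h⟩

open Classical in
/-- The Kreweras complement `Kr(π)` of a noncrossing partition `π`. -/
def kreweras {n : ℕ} (π : NC n) : NC n :=
  ⟨Finpartition.ofSetoid (krewerasSetoid π), by
    intro a b c d hab hbc hcd hac hbd
    simp only [part_ofSetoid_eq_iff] at *
    intro p q hpq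
    have h1 := hac p q hpq
    have h2 := hbd p q hpq
    simp only [Set.mem_uIoc, Fin.lt_def, Fin.le_def] at *
    omega⟩

/-- `π ∪ σ` as a relation on the points `0 < 0̄ < 1 < 1̄ < ⋯`, where `π` lives on the points without
bar (encoded as `(i, false)`) and `σ` on those with bar (encoded as `(i, true)`). -/
def interleave {n : ℕ} (π σ : NC n) (u v : Fin n ×ₗ Bool) : Prop :=
  ((ofLex u).2 = false ∧ (ofLex v).2 = false ∧ π.1.part (ofLex u).1 = π.1.part (ofLex v).1) ∨
    ((ofLex u).2 = true ∧ (ofLex v).2 = true ∧ σ.1.part (ofLex u).1 = σ.1.part (ofLex v).1)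

/-- The Kreweras complement is the largest `σ` for which `π ∪ σ` is noncrossing. -/
theorem isGreatest_kreweras {n : ℕ} (π : NC n) :
    IsGreatest {σ : NC n | IsNoncrossing (interleave π σ)} (kreweras π) := by
  have key : ∀ i j : Fin n, (kreweras π).1.part i = (kreweras π).1.part j ↔
      ∀ p q : Fin n, π.1.part p = π.1.part q → (p ∈ Set.uIoc i j ↔ q ∈ Set.uIoc i j) :=
    fun i j => part_ofSetoid_eq_iff (krewerasSetoid π) i j
  constructor
  · rintro ⟨a, a'⟩ ⟨b, b'⟩ ⟨c, c'⟩ ⟨d, d'⟩ hab hbc hcd hac hbd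
    change toLex (a, a') < toLex (b, b') at hab
    change toLex (b, b') < toLex (c, c') at hbc
    change toLex (c, c') < toLex (d, d') at hcd
    change (a' = false ∧ c' = false ∧ π.1.part a = π.1.part c) ∨
      (a' = true ∧ c' = true ∧ (kreweras π).1.part a = (kreweras π).1.part c) at hac
    change (b' = false ∧ d' = false ∧ π.1.part b = π.1.part d) ∨
      (b' = true ∧ d' = true ∧ (kreweras π).1.part b = (kreweras π).1.part d) at hbd
    change (a' = false ∧ b' = false ∧ π.1.part a = π.1.part b) ∨
      (a' = true ∧ b' = true ∧ (kreweras π).1.part a = (kreweras π).1.part b)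
    rw [Prod.Lex.toLex_lt_toLex] at hab hbc hcd
    rcases hac with ⟨rfl, rfl, hac⟩ | ⟨rfl, rfl, hac⟩ <;>
      rcases hbd with ⟨rfl, rfl, hbd⟩ | ⟨rfl, rfl, hbd⟩ <;>
      simp [Bool.lt_iff] at hab hbc hcd ⊢
    · exact π.2 a b c d hab hbc hcd hac hbd
    · have h := (key b d).1 hbd a c hac
      simp only [Set.mem_uIoc, Fin.lt_def, Fin.le_def, Fin.ext_iff] at h hab hbc hcd
      omega
    · have h := (key a c).1 hac b d hbd
      simp only [Set.mem_uIoc, Fin.lt_def, Fin.le_def, Fin.ext_iff] at h hab hbc hcd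
      omega
    · exact (kreweras π).2 a b c d hab hbc hcd hac hbd
  · intro σ hσ
    have hlt : ∀ i j : Fin n, i < j → σ.1.part i = σ.1.part j → ∀ p q : Fin n,
        π.1.part p = π.1.part q → p ∈ Set.Ioc i j → q ∈ Set.Ioc i j := by
      intro i j hij hs p q hpq hp
      by_contra hq
      rw [Set.mem_Ioc] at hp hq
      have hcase : q ≤ i ∨ j < q := by grind
      rcases hcase with hqi | hjq
      · have := hσ (toLex (q, false)) (toLex (i, true)) (toLex (p, false)) (toLex (j, true))
          (by rw [Prod.Lex.toLex_lt_toLex]; simp [Bool.lt_iff]; exact hqi.lt_or_eq)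
          (by rw [Prod.Lex.toLex_lt_toLex]; simp [Bool.lt_iff]; exact hp.1)
          (by rw [Prod.Lex.toLex_lt_toLex]; simp [Bool.lt_iff]; exact hp.2.lt_or_eq)
          (Or.inl ⟨rfl, rfl, hpq.symm⟩) (Or.inr ⟨rfl, rfl, hs⟩)
        simp [interleave] at this
      · have := hσ (toLex (i, true)) (toLex (p, false)) (toLex (j, true)) (toLex (q, false))
          (by rw [Prod.Lex.toLex_lt_toLex]; simp [Bool.lt_iff]; exact hp.1)
          (by rw [Prod.Lex.toLex_lt_toLex]; simp [Bool.lt_iff]; exact hp.2.lt_or_eq)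
          (by rw [Prod.Lex.toLex_lt_toLex]; simp [Bool.lt_iff]; exact hjq)
          (Or.inr ⟨rfl, rfl, hs⟩) (Or.inl ⟨rfl, rfl, hpq⟩)
        simp [interleave] at this
    have hle : ∀ i j : Fin n, σ.1.part i = σ.1.part j →
        (kreweras π).1.part i = (kreweras π).1.part j := by
      intro i j hs
      rw [key]
      intro p q hpq
      rcases lt_trichotomy i j with h | rfl | h
      · rw [Set.uIoc_of_le h.le]
        exact ⟨hlt i j h hs p q hpq, hlt i j h hs q p hpq.symm⟩
      · simp
      · rw [Set.uIoc_of_ge h.le]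
        exact ⟨hlt j i h hs.symm p q hpq, hlt j i h hs.symm q p hpq.symm⟩
    intro V hV
    obtain ⟨i, hi⟩ := σ.1.nonempty_of_mem_parts hV
    refine ⟨(kreweras π).1.part i, (Finpartition.part_mem _).2 (Finset.mem_univ i), ?_⟩
    intro j hj
    rw [Finpartition.mem_part_iff_part_eq_part _ (Finset.mem_univ j) (Finset.mem_univ i)]
    apply hle
    rw [σ.1.part_eq_of_mem hV hi, σ.1.part_eq_of_mem hV hj]

/-! ### Formal series without constant term -/

/-- `Θ_s`: formal series `∑_{n ≥ 1} ∑_{i_1, …, i_n} c_{i_1, …, i_n} z_{i_1} ⋯ z_{i_n}` with complex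
coefficients in `s` noncommuting indeterminates; `f.1 n w` is the coefficient of the word `w` of
length `n`, and there is no constant term. -/
abbrev Theta (s : ℕ) : Submodule ℂ ((n : ℕ) → (Fin n → Fin s) → ℂ) where
  carrier := {f | f 0 = 0}
  add_mem' {f g} hf hg := by
    simp only [Set.mem_ofPred_eq] at *
    rw [Pi.add_apply, hf, hg, add_zero]
  zero_mem' := rfl
  smul_mem' c f hf := by
    simp only [Set.mem_ofPred_eq] at *
    rw [Pi.smul_apply, hf, smul_zero]

/-- The series with the given coefficients at words of positive length. -/
def Theta.mk {s : ℕ} (c : (n : ℕ) → (Fin n → Fin s) → ℂ) : Theta s :=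
  ⟨fun n w => if n = 0 then 0 else c n w, by ext; simp⟩

/-- The series `f(z_{e 1}, …, z_{e s})` in `t` indeterminates. -/
def Theta.subst {s t : ℕ} (e : Fin s → Fin t) (f : Theta s) : Theta t :=
  Theta.mk fun n w => ∑ v : Fin n → Fin s, if e ∘ v = w then f.1 n v else 0

/-- The boxed convolution of Nica and Speicher: the coefficient of the word `w` of length `n` is
the sum over `π` in `NC n` of the product of the `π`-coefficient of `f` and the
`Kr(π)`-coefficient of `g` at `w`. -/
def Theta.boxedConv {s : ℕ} (f g : Theta s) : Theta s :=
  Theta.mk fun _ w => ∑ π, blockProd f.1 π w * blockProd g.1 (kreweras π) w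

/-! ### Moments, cumulants, R-transforms and freeness for a linear functional -/

section Functional

variable {A : Type*} [Ring A] [Algebra ℂ A]

/-- The moment `φ(a_1 ⋯ a_n)`. -/
def moment (φ : A →ₗ[ℂ] ℂ) (n : ℕ) (a : Fin n → A) : ℂ := φ (List.ofFn a).prod

/-- The cumulant `k_n(a_1, …, a_n) = ∑_{π ∈ NC n} φ_π(a_1, …, a_n) μ(π, 1_n)`. -/
def cumulant (φ : A →ₗ[ℂ] ℂ) (n : ℕ) (a : Fin n → A) : ℂ :=
  ∑ π : NC n, blockProd (moment φ) π a * π.moebius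

/-- The R-transform `r_{x_1, …, x_s}`: the formal series whose coefficients are the cumulants. -/
def rTransform (φ : A →ₗ[ℂ] ℂ) {s : ℕ} (x : Fin s → A) : Theta s :=
  Theta.mk fun n w => cumulant φ n (x ∘ w)

/-- A family of unital subalgebras is free if all mixed cumulants vanish. -/
def FreeSubalgebras (φ : A →ₗ[ℂ] ℂ) {ι : Type*} (S : ι → Subalgebra ℂ A) : Prop :=
  ∀ (n : ℕ) (a : Fin n → A) (c : Fin n → ι), (∀ i, a i ∈ S (c i)) →
    (∃ i j, c i ≠ c j) → cumulant φ n a = 0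

/-- Two subsets are free if the unital subalgebras that they generate are free. -/
def FreeSets (φ : A →ₗ[ℂ] ℂ) (X Y : Set A) : Prop :=
  FreeSubalgebras φ ![Algebra.adjoin ℂ X, Algebra.adjoin ℂ Y]

end Functional

/-! ### Towers of amalgamated noncommutative probability spaces -/

/-- A conditional expectation of `T` onto its unital subalgebra `S`. -/
def IsCondExp {𝒜 : Type*} [Ring 𝒜] [Algebra ℂ 𝒜] {S T : Subalgebra ℂ 𝒜} (h : S ≤ T)
    (φ : T →ₗ[ℂ] S) : Prop :=
  (∀ b : S, φ (Subalgebra.inclusion h b) = b) ∧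
    ∀ (b b' : S) (x : T),
      φ (Subalgebra.inclusion h b * x * Subalgebra.inclusion h b') = b * φ x * b'

/-- A tower `ℂ ⊂ B = A_0 ⊂ A_1 ⊂ A_2 ⊂ ⋯` of unital algebras (inside some algebra `𝒜`), with a
linear functional `φ_0 : B → ℂ` and conditional expectations `φ_{n+1} : A_{n+1} → A_n`. -/
structure NCPTower (𝒜 : Type*) [Ring 𝒜] [Algebra ℂ 𝒜] where
  /-- the algebras `A_n`, with `A_0 = B` -/
  alg : ℕ → Subalgebra ℂ 𝒜
  le_succ : ∀ n, alg n ≤ alg (n + 1)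
  /-- the linear functional `φ_0` on `B` -/
  phiZero : alg 0 →ₗ[ℂ] ℂ
  /-- `phi n` is the conditional expectation `φ_{n+1}` -/
  phi : ∀ n, alg (n + 1) →ₗ[ℂ] alg n
  isCondExp : ∀ n, IsCondExp (le_succ n) (phi n)

namespace NCPTower

variable {𝒜 : Type*} [Ring 𝒜] [Algebra ℂ 𝒜] (T : NCPTower 𝒜)

theorem alg_mono : Monotone T.alg := monotone_nat_of_le_succ T.le_succ

/-- The linear functional `E_n = φ_0 φ_1 ⋯ φ_n` on `A_n`. -/
def E : (n : ℕ) → T.alg n →ₗ[ℂ] ℂ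
  | 0 => T.phiZero
  | n + 1 => (E n).comp (T.phi n)

theorem E_compat {m n : ℕ} (h : m ≤ n) (a : 𝒜) (hm : a ∈ T.alg m) (hn : a ∈ T.alg n) :
    T.E n ⟨a, hn⟩ = T.E m ⟨a, hm⟩ := by
  induction n, h using Nat.le_induction with
  | base => rfl
  | succ n h ih =>
    have hn' : a ∈ T.alg n := T.alg_mono h hm
    rw [← ih hn']
    exact congrArg (T.E n) ((T.isCondExp n).1 ⟨a, hn'⟩)

/-- The enveloping algebra `A_∞`, the union of the algebras `A_n`. -/
def envAlg : Subalgebra ℂ 𝒜 := ⨆ n, T.alg n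

theorem mem_envAlg {a : 𝒜} : a ∈ T.envAlg ↔ ∃ n, a ∈ T.alg n := by
  rw [← SetLike.mem_coe, envAlg, Subalgebra.coe_iSup_of_directed T.alg_mono.directed_le]
  simp

/-- The value `E_∞(x) = E_n(x)` for any `n` with `x ∈ A_n`. -/
def envFun (x : T.envAlg) : ℂ :=
  T.E (T.mem_envAlg.1 x.2).choose ⟨x, (T.mem_envAlg.1 x.2).choose_spec⟩

theorem envFun_eq (x : T.envAlg) (n : ℕ) (h : (x : 𝒜) ∈ T.alg n) :
    T.envFun x = T.E n ⟨x, h⟩ := by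
  rcases le_total (T.mem_envAlg.1 x.2).choose n with hle | hle
  · exact (T.E_compat hle _ _ _).symm
  · exact T.E_compat hle _ _ _

/-- The linear functional `E_∞` on `A_∞`. -/
def envE : T.envAlg →ₗ[ℂ] ℂ where
  toFun := T.envFun
  map_add' x y := by
    obtain ⟨m, hm⟩ := T.mem_envAlg.1 x.2
    obtain ⟨n, hn⟩ := T.mem_envAlg.1 y.2
    have hx := T.alg_mono (le_max_left m n) hm
    have hy := T.alg_mono (le_max_right m n) hn
    rw [T.envFun_eq x _ hx, T.envFun_eq y _ hy,
      T.envFun_eq (x + y) (max m n) (add_mem hx hy), ← map_add]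
    rfl
  map_smul' c x := by
    obtain ⟨m, hm⟩ := T.mem_envAlg.1 x.2
    rw [T.envFun_eq x _ hm, T.envFun_eq (c • x) m (Subalgebra.smul_mem _ hm c), RingHom.id_apply,
      ← map_smul]
    rfl

/-- The set `A_m ∪ A_{m+1} ∪ ⋯ ∪ A_n`, empty if `n < m`. -/
def levels (m n : ℕ) : Set 𝒜 := ⋃ j ∈ Set.Icc m n, (T.alg j : Set 𝒜)

theorem mem_alg_of_mem_levels {m n p : ℕ} {a : 𝒜} (ha : a ∈ T.levels m n) (h : n ≤ p) :
    a ∈ T.alg p := by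
  simp only [levels, Set.mem_iUnion, Set.mem_Icc] at ha
  obtain ⟨j, hj, ha⟩ := ha
  exact T.alg_mono (hj.2.trans h) ha

/-- Elements of the first `n` levels, regarded as elements of `A_p`, where `n ≤ p`. -/
def toAlg {s m n : ℕ} (x : Fin s → 𝒜) (hx : ∀ i, x i ∈ T.levels m n) (p : ℕ) (h : n ≤ p) :
    Fin s → T.alg p :=
  fun i => ⟨x i, T.mem_alg_of_mem_levels (hx i) h⟩

/-- Elements of the first `n` levels, regarded as elements of `A_∞`. -/
def toEnv {s m n : ℕ} (x : Fin s → 𝒜) (hx : ∀ i, x i ∈ T.levels m n) : Fin s → T.envAlg :=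
  fun i => ⟨x i, T.mem_envAlg.2 ⟨n, T.mem_alg_of_mem_levels (hx i) le_rfl⟩⟩

end NCPTower

end

noncomputable section

/-! ### Noncrossing partitions as equivalence relations -/

section NCRel

open Finset

variable {m n : ℕ}

/-! The tower enters only through compatibility: each `E p` is the restriction of `T.envE` to `T.alg
p`. Cumulants are universal expressions in moments, so they do not change under the inclusions
(`cumulant_comp_algHom`, `NCPTower.rTransform_inclusion`). Every claim thus reduces to two free
families in the single space `(T.alg l, T.E l)`.

There, the joint R-transform and the R-transform of sums need only the vanishing of mixed cumulants
and, for sums, multilinearity. Products need more. By the moment-cumulant formula, a moment of the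
word `x₁ y₁ x₂ y₂ ⋯` is a sum over `NC (n * 2)`. Freeness kills every partition with a block of
mixed parity, and the surviving ones are the pairs `(π, σ)` with `σ ≤ kreweras π`
(`FreeSets.moment_mul`). On the other side, summing the coefficients of the boxed convolution over
the blocks of all `ρ` gives a sum over `π ≤ ρ` of terms in `π` and `ρ ∧ Kr(π)`. For fixed `π`, the
map `ρ ↦ ρ ∧ Kr(π)` is a bijection of `[π, 1]` onto `[0, Kr(π)]` (`NC.sum_inf_kreweras`), so the two
sums agree. The coefficients of the boxed convolution therefore solve the moment-cumulant formula
for the products, and Möbius inversion (`sum_blockProd_mul_moebius`) identifies them with the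
cumulants.

The lattice part works with blocks as equivalence relations. The bijection rests on
`NC.le_sup_inf_kreweras` and `NC.sup_inf_kreweras_le`, together with the fact that the join of
equivalence relations is already noncrossing here (`NC.sup_noncrossing`). -/

/-- Lying in the same block of `π`. -/
def NC.rel (π : NC n) : Setoid (Fin n) := Setoid.ker π.1.part

theorem NC.rel_iff {π : NC n} {i j : Fin n} : π.rel i j ↔ π.1.part i = π.1.part j := Iff.rfl

theorem NC.rel_noncrossing (π : NC n) : IsNoncrossing fun i j => π.rel i j := π.2

theorem NC.mem_part {π : NC n} {i j : Fin n} : j ∈ π.1.part i ↔ π.rel j i :=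
  π.1.mem_part_iff_part_eq_part (mem_univ j) (mem_univ i)

theorem NC.part_mem (π : NC n) (i : Fin n) : π.1.part i ∈ π.1.parts :=
  (Finpartition.part_mem _).2 (mem_univ i)

theorem NC.exists_eq_part {π : NC n} {V : Finset (Fin n)} (hV : V ∈ π.1.parts) :
    ∃ i, V = π.1.part i := by
  obtain ⟨i, hi⟩ := π.1.nonempty_of_mem_parts hV
  exact ⟨i, (π.1.part_eq_of_mem hV hi).symm⟩

theorem NC.rel_of_mem {π : NC n} {V : Finset (Fin n)} (hV : V ∈ π.1.parts) {i j : Fin n}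
    (hi : i ∈ V) (hj : j ∈ V) : π.rel i j := by
  rw [NC.rel_iff, π.1.part_eq_of_mem hV hi, π.1.part_eq_of_mem hV hj]

theorem NC.mem_of_rel {π : NC n} {V : Finset (Fin n)} (hV : V ∈ π.1.parts) {i j : Fin n}
    (hi : i ∈ V) (h : π.rel i j) : j ∈ V := by
  rw [← π.1.part_eq_of_mem hV hi]
  exact NC.mem_part.2 (π.rel.symm h)

open Classical in
/-- The noncrossing partition whose blocks are the classes of `r`. -/
def NC.ofRel (r : Setoid (Fin n)) (h : IsNoncrossing fun i j => r i j) : NC n :=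
  ⟨Finpartition.ofSetoid r, by simpa only [part_ofSetoid_eq_iff] using h⟩

@[simp] theorem NC.rel_ofRel (r : Setoid (Fin n)) (h : IsNoncrossing fun i j => r i j) :
    (NC.ofRel r h).rel = r :=
  Setoid.ext fun i j => part_ofSetoid_eq_iff r i j

theorem NC.rel_kreweras (π : NC n) : (kreweras π).rel = krewerasSetoid π :=
  Setoid.ext fun i j => part_ofSetoid_eq_iff _ i j

theorem NC.le_iff {π σ : NC n} : π ≤ σ ↔ π.rel ≤ σ.rel := by
  constructor
  · intro h i j hij
    obtain ⟨W, hW, hle⟩ := h (π.part_mem i)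
    exact NC.rel_of_mem hW (hle (NC.mem_part.2 (π.rel.refl i)))
      (hle (NC.mem_part.2 (π.rel.symm hij)))
  · intro h V hV
    obtain ⟨i, rfl⟩ := NC.exists_eq_part hV
    refine ⟨σ.1.part i, σ.part_mem i, fun j hj => ?_⟩
    exact NC.mem_part.2 (h (NC.mem_part.1 hj))

theorem NC.rel_injective : Function.Injective (NC.rel : NC n → Setoid (Fin n)) := fun _ _ h =>
  le_antisymm (NC.le_iff.2 h.le) (NC.le_iff.2 h.ge)

theorem NC.le_one (π : NC n) : π ≤ NC.one n := le_top (α := Finpartition (univ : Finset (Fin n)))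

/-- The restriction of a noncrossing partition along an order embedding. -/
def NC.comap (e : Fin m ↪o Fin n) (π : NC n) : NC m :=
  NC.ofRel (Setoid.comap e π.rel) (by
    intro a b c d hab hbc hcd hac hbd
    exact π.rel_noncrossing (e a) (e b) (e c) (e d) (e.lt_iff_lt.2 hab) (e.lt_iff_lt.2 hbc)
      (e.lt_iff_lt.2 hcd) hac hbd)

theorem NC.rel_comap {e : Fin m ↪o Fin n} {π : NC n} {a b : Fin m} :
    (π.comap e).rel a b ↔ π.rel (e a) (e b) :=
  Setoid.ext_iff.1 (NC.rel_ofRel (Setoid.comap e π.rel) _) a b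

/-- The length of the word is a dependent index of `f`, so a known cardinality cannot simply be
rewritten. -/
theorem apply_orderEmbOfFin {α : Type*} (f : (m : ℕ) → (Fin m → α) → ℂ) (V : Finset (Fin n))
    (a : Fin n → α) (h : V.card = m) :
    f V.card (a ∘ V.orderEmbOfFin rfl) = f m (a ∘ V.orderEmbOfFin h) := by
  subst h; rfl

theorem apply_orderEmbOfFin_map {α : Type*} (f : (m : ℕ) → (Fin m → α) → ℂ)
    (e : Fin m ↪o Fin n) (W : Finset (Fin m)) (a : Fin n → α) :
    f (W.map e.toEmbedding).card (a ∘ (W.map e.toEmbedding).orderEmbOfFin rfl) =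
      f W.card ((a ∘ e) ∘ W.orderEmbOfFin rfl) := by
  rw [apply_orderEmbOfFin f _ a (card_map e.toEmbedding)]
  congr 1
  rw [Function.comp_assoc]
  congr 1
  refine (orderEmbOfFin_unique (card_map e.toEmbedding) (fun x => ?_) ?_).symm
  · exact mem_map_of_mem _ (orderEmbOfFin_mem _ _ _)
  · exact e.strictMono.comp (OrderEmbedding.strictMono _)

theorem apply_orderEmbOfFin_univ {α : Type*} (f : (m : ℕ) → (Fin m → α) → ℂ) (a : Fin n → α) :
    f (univ : Finset (Fin n)).card (a ∘ (univ : Finset (Fin n)).orderEmbOfFin rfl) = f n a := by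
  rw [apply_orderEmbOfFin f _ a (card_fin n)]
  congr 1
  rw [← orderEmbOfFin_unique (card_fin n) (f := id) (fun x => mem_univ _) strictMono_id]
  rfl

theorem NC.parts_one (hn : n ≠ 0) : (NC.one n).1.parts = {univ} := by
  have := Fin.pos_iff_nonempty.1 (Nat.pos_of_ne_zero hn)
  have h := Finpartition.parts_top_subset (univ : Finset (Fin n))
  obtain ⟨i⟩ := this
  rcases subset_singleton_iff.1 h with h | h
  · have := (NC.one n).part_mem i
    rw [NC.one, h] at this
    simp at this
  · exact h

theorem blockProd_one {α : Type*} (f : (m : ℕ) → (Fin m → α) → ℂ) (hn : n ≠ 0) (a : Fin n → α) :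
    blockProd f (NC.one n) a = f n a := by
  rw [blockProd, NC.parts_one hn, prod_singleton, apply_orderEmbOfFin_univ f]

theorem NC.eq_one_of_card_eq {π : NC n} {V : Finset (Fin n)} (hV : V ∈ π.1.parts)
    (h : V.card = n) : π = NC.one n := by
  have hu : V = univ := (card_eq_iff_eq_univ V).1 (by simpa using h)
  refine le_antisymm π.le_one (NC.le_iff.2 fun i j _ => ?_)
  exact NC.rel_of_mem hV (hu ▸ mem_univ i) (hu ▸ mem_univ j)

/-- The hypothesis says that the range of `e` is a union of blocks of `π`, so restricting along `e`
cuts no block. -/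
theorem NC.part_comap {e : Fin m ↪o Fin n} {π : NC n}
    (h : ∀ a i, π.rel i (e a) → i ∈ Set.range e) (a : Fin m) :
    ((π.comap e).1.part a).map e.toEmbedding = π.1.part (e a) := by
  ext i
  rw [mem_map, NC.mem_part]
  constructor
  · rintro ⟨b, hb, rfl⟩
    exact NC.rel_comap.1 (NC.mem_part.1 hb)
  · intro hi
    obtain ⟨b, rfl⟩ := h a i hi
    exact ⟨b, NC.mem_part.2 (NC.rel_comap.2 hi), rfl⟩

/-! ### Splitting and gluing partitions along a family of embeddings -/

section Family

variable {J : Type*} {l : J → ℕ} {e : ∀ j, Fin (l j) ↪o Fin n}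

/-- If `Fin n` is covered by the ranges of the order embeddings `e j` and every block of `π` lies in
exactly one of them, then the product over the blocks of `π` splits accordingly. -/
theorem blockProd_eq_prod_comap {α : Type*} [Fintype J] (hcov : ∀ i, ∃ j a, e j a = i) {π : NC n}
    (hcl : ∀ j j' a b, π.rel (e j a) (e j' b) → j = j') (f : (m : ℕ) → (Fin m → α) → ℂ)
    (a : Fin n → α) : blockProd f π a = ∏ j, blockProd f (π.comap (e j)) (a ∘ e j) := by
  have hr : ∀ j x i, π.rel i (e j x) → i ∈ Set.range (e j) := by
    intro j x i hi
    obtain ⟨j', b, rfl⟩ := hcov i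
    obtain rfl := hcl _ _ _ _ hi
    exact ⟨b, rfl⟩
  simp only [blockProd]
  rw [Finset.prod_sigma']
  symm
  refine prod_bij (fun p _ => p.2.map (e p.1).toEmbedding) ?_ ?_ ?_ ?_
  · rintro ⟨j, W⟩ hW
    replace hW : W ∈ (π.comap (e j)).1.parts := (mem_sigma.1 hW).2
    obtain ⟨x, rfl⟩ := NC.exists_eq_part hW
    dsimp only
    rw [NC.part_comap (hr j)]
    exact π.part_mem _
  · rintro ⟨j, W⟩ hW ⟨j', W'⟩ hW' h
    replace hW : W ∈ (π.comap (e j)).1.parts := (mem_sigma.1 hW).2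
    obtain ⟨x, rfl⟩ := NC.exists_eq_part hW
    replace hW' : W' ∈ (π.comap (e j')).1.parts := (mem_sigma.1 hW').2
    obtain ⟨x', rfl⟩ := NC.exists_eq_part hW'
    have h2 := h
    dsimp only at h2
    rw [NC.part_comap (hr j), NC.part_comap (hr j')] at h2
    obtain rfl := hcl _ _ _ _ h2
    exact congrArg (Sigma.mk j) (Finset.map_injective _ h)
  · intro V hV
    obtain ⟨i, rfl⟩ := NC.exists_eq_part hV
    obtain ⟨j, x, rfl⟩ := hcov i
    exact ⟨⟨j, _⟩, mem_sigma.2 ⟨mem_univ _, NC.part_mem _ x⟩, NC.part_comap (hr j) x⟩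
  · rintro ⟨j, W⟩ hW
    exact (apply_orderEmbOfFin_map f (e j) W a).symm

/-- The equivalence relation obtained from partitions `p j` carried by the disjoint ranges of the
order embeddings `e j`. -/
def NC.glue (hcov : ∀ i, ∃ j a, e j a = i) (hdisj : ∀ j j' a b, e j a = e j' b → j = j')
    (p : ∀ j, NC (l j)) : Setoid (Fin n) where
  r i i' := ∃ j a b, e j a = i ∧ e j b = i' ∧ (p j).rel a b
  iseqv :=
    { refl := fun i => by
        obtain ⟨j, a, rfl⟩ := hcov i
        exact ⟨j, a, a, rfl, rfl, (p j).rel.refl a⟩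
      symm := by
        rintro _ _ ⟨j, a, b, rfl, rfl, h⟩
        exact ⟨j, b, a, rfl, rfl, (p j).rel.symm h⟩
      trans := by
        rintro _ _ _ ⟨j, a, b, rfl, rfl, h⟩ ⟨j', a', b', h1, rfl, h'⟩
        obtain rfl := hdisj _ _ _ _ h1
        obtain rfl := (e j').injective h1
        exact ⟨j', a, b', rfl, rfl, (p j').rel.trans h h'⟩ }

variable {hcov : ∀ i, ∃ j a, e j a = i} {hdisj : ∀ j j' a b, e j a = e j' b → j = j'}
  {p : ∀ j, NC (l j)}

theorem NC.glue_apply {j : J} {a b : Fin (l j)} :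
    NC.glue hcov hdisj p (e j a) (e j b) ↔ (p j).rel a b := by
  constructor
  · rintro ⟨j', a', b', h1, h2, h⟩
    obtain rfl := hdisj _ _ _ _ h1
    rwa [(e j').injective h1, (e j').injective h2] at h
  · exact fun h => ⟨j, a, b, rfl, rfl, h⟩

theorem NC.eq_of_glue {j j' : J} {a : Fin (l j)} {b : Fin (l j')}
    (h : NC.glue hcov hdisj p (e j a) (e j' b)) : j = j' := by
  obtain ⟨i, a', b', h1, h2, -⟩ := h
  exact (hdisj _ _ _ _ h1).symm.trans (hdisj _ _ _ _ h2)

theorem NC.comap_ofRel_glue (h : IsNoncrossing fun i j => NC.glue hcov hdisj p i j) (j : J) :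
    (NC.ofRel _ h).comap (e j) = p j := by
  refine NC.rel_injective (Setoid.ext fun a b => ?_)
  rw [NC.rel_comap, NC.rel_ofRel, NC.glue_apply]

theorem NC.ofRel_glue_comap {π : NC n} (hcl : ∀ j j' a b, π.rel (e j a) (e j' b) → j = j')
    (h : IsNoncrossing fun i i' => NC.glue hcov hdisj (fun j => π.comap (e j)) i i') :
    NC.ofRel _ h = π := by
  refine NC.rel_injective (Setoid.ext fun i i' => ?_)
  rw [NC.rel_ofRel]
  obtain ⟨j, a, rfl⟩ := hcov i
  obtain ⟨j', b, rfl⟩ := hcov i'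
  constructor
  · intro h
    obtain rfl := NC.eq_of_glue h
    exact NC.rel_comap.1 ((NC.glue_apply (p := fun j => π.comap (e j))).1 h)
  · intro h
    obtain rfl := hcl _ _ _ _ h
    exact (NC.glue_apply (p := fun j => π.comap (e j))).2 (NC.rel_comap.2 h)

end Family

/-! ### Refinements of a noncrossing partition -/

/-- The inclusion of a block. -/
def NC.blockEmb (ρ : NC n) (V : ρ.1.parts) : Fin V.1.card ↪o Fin n := V.1.orderEmbOfFin rfl

theorem NC.blockEmb_mem (ρ : NC n) (V : ρ.1.parts) (a : Fin V.1.card) : ρ.blockEmb V a ∈ V.1 :=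
  orderEmbOfFin_mem _ _ _

theorem NC.exists_blockEmb_of_mem (ρ : NC n) (V : ρ.1.parts) {i : Fin n} (hi : i ∈ V.1) :
    ∃ a, ρ.blockEmb V a = i := by
  have := range_orderEmbOfFin V.1 rfl
  exact (Set.ext_iff.1 this i).2 hi

theorem NC.exists_blockEmb (ρ : NC n) (i : Fin n) : ∃ V a, ρ.blockEmb V a = i :=
  ⟨⟨_, ρ.part_mem i⟩, ρ.exists_blockEmb_of_mem _ (NC.mem_part.2 (ρ.rel.refl i))⟩

theorem NC.rel_blockEmb (ρ : NC n) (V : ρ.1.parts) (a b : Fin V.1.card) :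
    ρ.rel (ρ.blockEmb V a) (ρ.blockEmb V b) :=
  NC.rel_of_mem V.2 (ρ.blockEmb_mem V a) (ρ.blockEmb_mem V b)

theorem NC.part_blockEmb (ρ : NC n) (V : ρ.1.parts) (a : Fin V.1.card) :
    ρ.1.part (ρ.blockEmb V a) = V.1 :=
  ρ.1.part_eq_of_mem V.2 (ρ.blockEmb_mem V a)

theorem NC.eq_of_rel_blockEmb (ρ : NC n) (V V' : ρ.1.parts) (a : Fin V.1.card) (b : Fin V'.1.card)
    (h : ρ.rel (ρ.blockEmb V a) (ρ.blockEmb V' b)) : V = V' := by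
  rw [NC.rel_iff, NC.part_blockEmb, NC.part_blockEmb] at h
  exact Subtype.ext h

theorem NC.eq_of_blockEmb_eq (ρ : NC n) (V V' : ρ.1.parts) (a : Fin V.1.card)
    (b : Fin V'.1.card) (h : ρ.blockEmb V a = ρ.blockEmb V' b) : V = V' :=
  ρ.eq_of_rel_blockEmb V V' a b (h ▸ ρ.rel.refl _)

theorem NC.eq_of_le_of_rel_blockEmb {π ρ : NC n} (hle : π ≤ ρ) (V V' : ρ.1.parts)
    (a : Fin V.1.card) (b : Fin V'.1.card) (h : π.rel (ρ.blockEmb V a) (ρ.blockEmb V' b)) :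
    V = V' :=
  ρ.eq_of_rel_blockEmb V V' a b (NC.le_iff.1 hle h)

theorem blockProd_eq_prod_parts {α : Type*} {π ρ : NC n} (hle : π ≤ ρ)
    (f : (m : ℕ) → (Fin m → α) → ℂ) (a : Fin n → α) :
    blockProd f π a = ∏ V : ρ.1.parts, blockProd f (π.comap (ρ.blockEmb V)) (a ∘ ρ.blockEmb V) :=
  blockProd_eq_prod_comap ρ.exists_blockEmb (NC.eq_of_le_of_rel_blockEmb hle) f a

/-- A crossing between two blocks of `ρ` is excluded by `ρ`, and one inside a block `V` is excluded
by `p V`. -/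
theorem NC.glue_parts_noncrossing (ρ : NC n) (p : ∀ V : ρ.1.parts, NC V.1.card) :
    IsNoncrossing fun i j => NC.glue ρ.exists_blockEmb ρ.eq_of_blockEmb_eq p i j := by
  rintro a b c d hab hbc hcd ⟨V, a, c, rfl, rfl, hac⟩ ⟨V', b, d, rfl, rfl, hbd⟩
  obtain rfl := ρ.eq_of_rel_blockEmb V V' a b
    (ρ.rel_noncrossing _ _ _ _ hab hbc hcd (ρ.rel_blockEmb V a c) (ρ.rel_blockEmb V' b d))
  simp only [OrderEmbedding.lt_iff_lt] at hab hbc hcd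
  exact NC.glue_apply.2 ((p V).rel_noncrossing a b c d hab hbc hcd hac hbd)

open Classical in
/-- The refinements of `ρ` are the families of noncrossing partitions of the blocks of `ρ`. -/
theorem NC.sum_le_prod_comap (ρ : NC n) (F : ∀ V : ρ.1.parts, NC V.1.card → ℂ) :
    ∑ π with π ≤ ρ, ∏ V, F V (π.comap (ρ.blockEmb V)) = ∏ V, ∑ θ, F V θ := by
  rw [Finset.prod_univ_sum, Fintype.piFinset_univ]
  refine sum_bij' (fun π _ V => π.comap (ρ.blockEmb V))
    (fun p _ => NC.ofRel _ (ρ.glue_parts_noncrossing p)) (fun _ _ => mem_univ _) ?_ ?_ ?_ ?_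
  · intro p _
    simp only [mem_filter, mem_univ, true_and, NC.le_iff, NC.rel_ofRel]
    rintro _ _ ⟨V, a, b, rfl, rfl, -⟩
    exact ρ.rel_blockEmb V a b
  · intro π hπ
    exact NC.ofRel_glue_comap (NC.eq_of_le_of_rel_blockEmb (by simpa using hπ)) _
  · intro p _
    funext V
    exact NC.comap_ofRel_glue _ V
  · intros; rfl

end NCRel

/-! ### The intervals `[π, 1]` and `[0, Kr(π)]` -/

section Lattice

open Finset

variable {n : ℕ}

theorem NC.rel_kreweras_iff {π : NC n} {i j : Fin n} :
    (kreweras π).rel i j ↔ ∀ p q, π.rel p q → (p ∈ Set.uIoc i j ↔ q ∈ Set.uIoc i j) := by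
  rw [NC.rel_kreweras]; rfl

theorem NC.rel_kreweras_of_le {π : NC n} {i j : Fin n} (hij : i ≤ j)
    (h : ∀ p q, π.rel p q → i < p → p ≤ j → i < q ∧ q ≤ j) : (kreweras π).rel i j := by
  rw [NC.rel_kreweras_iff]
  intro p q hpq
  rw [Set.uIoc_of_le hij]
  exact ⟨fun hp => h p q hpq hp.1 hp.2, fun hq => h q p (π.rel.symm hpq) hq.1 hq.2⟩

theorem NC.mem_Ioc_of_rel_kreweras {π : NC n} {i j p q : Fin n} (h : (kreweras π).rel i j)
    (hpq : π.rel p q) (hip : i < p) (hpj : p ≤ j) : i < q ∧ q ≤ j := by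
  have := (NC.rel_kreweras_iff.1 h p q hpq)
  rw [Set.uIoc_of_le (hip.le.trans hpj)] at this
  exact this.1 ⟨hip, hpj⟩

/-- Inside a block of some `ρ ≥ π` only the points of that block matter for the Kreweras
complement of `π`. -/
theorem NC.rel_kreweras_of_rel {π ρ : NC n} (hle : π ≤ ρ) {i j : Fin n} (hij : i ≤ j)
    (hρ : ρ.rel i j)
    (h : ∀ p q, π.rel p q → ρ.rel i p → i < p → p ≤ j → i < q ∧ q ≤ j) :
    (kreweras π).rel i j := by
  refine NC.rel_kreweras_of_le hij fun p q hpq hip hpj => ?_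
  by_cases hp : ρ.rel i p
  · exact h p q hpq hp hip hpj
  -- The block of `ρ` through `p` and `q` misses `i` and `j`. If `q` were outside the interval, that
  -- block would cross the one of `i` and `j`.
  · have hpq' := NC.le_iff.1 hle hpq
    have hqi : q ≠ i := by rintro rfl; exact hp (ρ.rel.symm hpq')
    have hpj' : p ≠ j := by rintro rfl; exact hp hρ
    by_contra hq
    rcases lt_or_gt_of_ne hqi with hlt | hlt
    · exact hp (ρ.rel.symm (ρ.rel.trans hpq' (ρ.rel_noncrossing q i p j hlt hip
        (lt_of_le_of_ne hpj hpj') (ρ.rel.symm hpq') hρ)))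
    · have hjq : j < q := by
        by_contra hc; exact hq ⟨hlt, not_lt.1 hc⟩
      exact hp (ρ.rel_noncrossing i p j q hip (lt_of_le_of_ne hpj hpj') hjq hρ hpq')

/-- The relation with the two classes `S` and its complement contains both `r` and `s`, hence their
join. -/
theorem Setoid.sup_closed {α : Type*} {r s : Setoid α} {S : α → Prop}
    (hr : ∀ p q, r p q → S p → S q) (hs : ∀ p q, s p q → S p → S q) {i j : α}
    (h : (r ⊔ s) i j) (hi : S i) : S j := by
  have h1 : r ⊔ s ≤ Setoid.ker S := sup_le
    (fun p q h => propext ⟨hr p q h, hr q p (r.symm h)⟩)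
    (fun p q h => propext ⟨hs p q h, hs q p (s.symm h)⟩)
  exact (h1 h : S i = S j) ▸ hi

/-- A class of the join of `π` and `σ` that does not contain the neighbours `u` and `v` lies on one
side of them. -/
theorem NC.sup_rel_between {π σ : NC n} (h : σ ≤ kreweras π) {u v x y : Fin n}
    (huv : π.rel u v ∨ σ.rel u v) (hux : u < x) (hxv : x < v)
    (hxy : (π.rel ⊔ σ.rel) x y) (hxu : ¬ (π.rel ⊔ σ.rel) x u) : u < y ∧ y < v := by
  have hπ : π.rel ≤ π.rel ⊔ σ.rel := le_sup_left
  have hσ : σ.rel ≤ π.rel ⊔ σ.rel := le_sup_right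
  have hk := NC.le_iff.1 h
  set τ := π.rel ⊔ σ.rel
  have huv' : τ u v := huv.elim (fun h => hπ h) (fun h => hσ h)
  -- The endpoints are not in the class of `x`, so only jumps strictly beyond `u` or `v` remain to
  -- be excluded. If both pairs come from one partition, noncrossing does this (`same`); otherwise
  -- the Kreweras condition does.
  have side : ∀ r s, τ x r → τ r s → u < r → r < v →
      (s < u → False) → (v < s → False) → u < s ∧ s < v := by
    intro r s hxr hrs _ _ h1 h2
    have hxs := τ.trans hxr hrs
    refine ⟨lt_of_le_of_ne (not_lt.1 h1) ?_, lt_of_le_of_ne (not_lt.1 h2) ?_⟩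
    · rintro rfl; exact hxu hxs
    · rintro rfl; exact hxu (τ.trans hxs (τ.symm huv'))
  have same : ∀ κ : NC n, κ.rel ≤ τ → κ.rel u v → ∀ r s, κ.rel r s → τ x r → u < r → r < v →
      u < s ∧ s < v := by
    intro κ hκ hκuv r s hrs hxr hur hrv
    refine side r s hxr (hκ hrs) hur hrv (fun hs => ?_) (fun hs => ?_)
    · exact hxu (τ.trans hxr (hκ (κ.rel.trans hrs
        (κ.rel_noncrossing s u r v hs hur hrv (κ.rel.symm hrs) hκuv))))
    · exact hxu (τ.trans hxr (hκ (κ.rel.symm (κ.rel_noncrossing u r v s hur hrv hs hκuv hrs))))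
  have h1 : ∀ r s, π.rel r s → τ x r ∧ u < r ∧ r < v → τ x s ∧ u < s ∧ s < v := by
    rintro r s hrs ⟨hxr, hur, hrv⟩
    refine ⟨τ.trans hxr (hπ hrs), ?_⟩
    rcases huv with huv | huv
    · exact same π hπ huv r s hrs hxr hur hrv
    · have := NC.mem_Ioc_of_rel_kreweras (hk huv) hrs hur hrv.le
      exact side r s hxr (hπ hrs) hur hrv (fun hs => lt_asymm hs this.1)
        (fun hs => absurd this.2 (not_le.2 hs))
  have h2 : ∀ r s, σ.rel r s → τ x r ∧ u < r ∧ r < v → τ x s ∧ u < s ∧ s < v := by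
    rintro r s hrs ⟨hxr, hur, hrv⟩
    refine ⟨τ.trans hxr (hσ hrs), ?_⟩
    rcases huv with huv | huv
    · refine side r s hxr (hσ hrs) hur hrv (fun hs => ?_) (fun hs => ?_)
      · exact absurd (NC.mem_Ioc_of_rel_kreweras (hk (σ.rel.symm hrs)) huv hs hur.le).2
          (not_le.2 hrv)
      · exact lt_asymm hur
          (NC.mem_Ioc_of_rel_kreweras (hk hrs) (π.rel.symm huv) hrv hs.le).1
    · exact same σ hσ huv r s hrs hxr hur hrv
  exact (Setoid.sup_closed h1 h2 hxy ⟨τ.refl x, hux, hxv⟩).2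

/-- If `π ∪ σ` is noncrossing, then so is the join of `π` and `σ` as equivalence relations. -/
theorem NC.sup_noncrossing {π σ : NC n} (h : σ ≤ kreweras π) :
    IsNoncrossing fun i j => (π.rel ⊔ σ.rel) i j := by
  intro a b c d hab hbc hcd hac hbd
  have hπ : π.rel ≤ π.rel ⊔ σ.rel := le_sup_left
  have hσ : σ.rel ≤ π.rel ⊔ σ.rel := le_sup_right
  change (π.rel ⊔ σ.rel) a c at hac
  change (π.rel ⊔ σ.rel) b d at hbd
  change (π.rel ⊔ σ.rel) a b
  by_contra hne
  -- The part of the class of `b` between `a` and `c` is closed under both relations: a single step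
  -- leaving it would jump over `a` or `c` and so separate `a` from `c`, against
  -- `NC.sup_rel_between`. Then `d` could not lie beyond `c`.
  have key : ∀ p q, (π.rel p q ∨ σ.rel p q) → (π.rel ⊔ σ.rel) b p ∧ a < p ∧ p < c →
      (π.rel ⊔ σ.rel) b q ∧ a < q ∧ q < c := by
    rintro p q hpq ⟨hbp, hap, hpc⟩
    have hpq' : (π.rel ⊔ σ.rel) p q := hpq.elim (fun h => hπ h) (fun h => hσ h)
    generalize hτ : π.rel ⊔ σ.rel = τ at *
    have hbq : τ b q := τ.trans hbp hpq'
    refine ⟨hbq, ?_, ?_⟩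
    · by_contra hq
      rcases eq_or_lt_of_le (not_lt.1 hq) with rfl | hq
      · exact hne (τ.symm hbq)
      · have := NC.sup_rel_between h (hpq.imp π.rel.symm σ.rel.symm) hq hap (hτ ▸ hac)
          (hτ ▸ fun hh => hne (τ.trans hh (τ.symm hbq)))
        exact lt_asymm this.2 hpc
    · by_contra hq
      rcases eq_or_lt_of_le (not_lt.1 hq) with rfl | hq
      · exact hne (τ.trans hac (τ.symm hbq))
      · have := NC.sup_rel_between h hpq hpc hq (hτ ▸ τ.symm hac)
          (hτ ▸ fun hh => hne (τ.trans hac (τ.trans hh (τ.symm hbp))))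
        exact lt_asymm this.1 hap
  have := Setoid.sup_closed (fun p q hpq => key p q (Or.inl hpq))
    (fun p q hpq => key p q (Or.inr hpq)) hbd ⟨(π.rel ⊔ σ.rel).refl b, hab, hbc⟩
  exact lt_asymm this.2.2 hcd

theorem NC.inf_noncrossing (ρ σ : NC n) : IsNoncrossing fun i j => (ρ.rel ⊓ σ.rel) i j := by
  intro a b c d hab hbc hcd hac hbd
  exact ⟨ρ.rel_noncrossing a b c d hab hbc hcd hac.1 hbd.1,
    σ.rel_noncrossing a b c d hab hbc hcd hac.2 hbd.2⟩

/-- The join of `π` and some `σ ≤ Kr(π)`. -/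
def NC.sup {π σ : NC n} (h : σ ≤ kreweras π) : NC n := NC.ofRel _ (NC.sup_noncrossing h)

/-- The meet of two noncrossing partitions. -/
def NC.inf (ρ σ : NC n) : NC n := NC.ofRel _ (NC.inf_noncrossing ρ σ)

theorem NC.rel_inf {ρ σ : NC n} {i j : Fin n} :
    (ρ.inf σ).rel i j ↔ ρ.rel i j ∧ σ.rel i j :=
  Setoid.ext_iff.1 (NC.rel_ofRel _ (NC.inf_noncrossing ρ σ)) i j

theorem NC.rel_sup {π σ : NC n} (h : σ ≤ kreweras π) : (NC.sup h).rel = π.rel ⊔ σ.rel :=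
  NC.rel_ofRel _ _

open Classical in
/-- `ρ ≤ π ∨ (ρ ∧ Kr(π))` for `π ≤ ρ`. -/
theorem NC.le_sup_inf_kreweras {π ρ : NC n} (hle : π ≤ ρ) :
    ρ.rel ≤ π.rel ⊔ (ρ.inf (kreweras π)).rel := by
  have hπ : π.rel ≤ π.rel ⊔ (ρ.inf (kreweras π)).rel := le_sup_left
  have hσ : (ρ.inf (kreweras π)).rel ≤ π.rel ⊔ (ρ.inf (kreweras π)).rel := le_sup_right
  have hle' := NC.le_iff.1 hle
  generalize hτ : π.rel ⊔ (ρ.inf (kreweras π)).rel = τ at *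
  -- Strong induction on the larger point `v` reduces this to linking `v` with its predecessor in
  -- its block of `ρ`.
  suffices H : ∀ v u, u < v → ρ.rel u v → τ u v by
    intro i j hij
    rcases lt_trichotomy i j with h | rfl | h
    · exact H j i h hij
    · exact τ.refl i
    · exact τ.symm (H i j h (ρ.rel.symm hij))
  intro v
  induction v using WellFoundedLT.induction with
  | ind v ih =>
  intro u₀ hu₀ hρ₀
  -- the predecessor of `v` in its block of `ρ`
  obtain ⟨u, hu, humax⟩ := exists_max_image (univ.filter fun k => k < v ∧ ρ.rel k v) id
    ⟨u₀, by simp [hu₀, hρ₀]⟩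
  simp only [mem_filter, mem_univ, true_and, id] at hu humax
  obtain ⟨huv, hρuv⟩ := hu
  suffices huv' : τ u v by
    rcases eq_or_lt_of_le (humax u₀ ⟨hu₀, hρ₀⟩) with rfl | hlt
    · exact huv'
    · exact τ.trans (ih u huv u₀ hlt (ρ.rel.trans hρ₀ (ρ.rel.symm hρuv))) huv'
  -- If `v` has a predecessor `u'` in its block of `π`, the link goes from `u` to `u'` by `Kr(π)`
  -- and then to `v` by `π`. If `v` is the minimum of that block, it goes from `u` to the maximum
  -- `w` by `Kr(π)` and then to `v` by `π`.
  by_cases hmin : ∃ k, k < v ∧ π.rel k v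
  · obtain ⟨u', hu', hmax'⟩ := exists_max_image (univ.filter fun k => k < v ∧ π.rel k v) id
      (by obtain ⟨k, hk⟩ := hmin; exact ⟨k, by simpa using hk⟩)
    simp only [mem_filter, mem_univ, true_and, id] at hu' hmax'
    obtain ⟨hu'v, hπ'⟩ := hu'
    have hρ' : ρ.rel u' u := ρ.rel.trans (hle' hπ') (ρ.rel.symm hρuv)
    have hu'u := humax u' ⟨hu'v, hle' hπ'⟩
    have hkr : (kreweras π).rel u' u := by
      refine NC.rel_kreweras_of_rel hle hu'u hρ' fun p q hpq hρp hp hpu => ?_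
      have hpv : ¬ π.rel p v := fun hh => absurd (hmax' p ⟨hpu.trans_lt huv, hh⟩) (not_le.2 hp)
      have hqv : ¬ π.rel q v := fun hh => hpv (π.rel.trans hpq hh)
      have hq1 : q ≠ u' := by rintro rfl; exact hqv hπ'
      have hq2 : q ≠ v := by rintro rfl; exact hqv (π.rel.refl _)
      have hqρ : ρ.rel q v :=
        ρ.rel.trans (ρ.rel.symm (ρ.rel.trans hρp (hle' hpq))) (hle' hπ')
      refine ⟨lt_of_le_of_ne (not_lt.1 fun hlt => ?_) hq1.symm, humax q ⟨?_, hqρ⟩⟩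
      · exact hpv (π.rel.trans hpq (π.rel.trans
          (π.rel_noncrossing q u' p v hlt hp (hpu.trans_lt huv) (π.rel.symm hpq) hπ') hπ'))
      · refine lt_of_le_of_ne (not_lt.1 fun hlt => ?_) hq2
        exact hpv (π.rel.trans (π.rel.symm
          (π.rel_noncrossing u' p v q hp (hpu.trans_lt huv) hlt hπ' hpq)) hπ')
    exact τ.trans (τ.symm (hσ (NC.rel_inf.2 ⟨hρ', hkr⟩))) (hπ hπ')
  · push Not at hmin
    obtain ⟨w, hw, hwmax⟩ := exists_max_image (univ.filter fun k => π.rel v k) id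
      ⟨v, by simp⟩
    simp only [mem_filter, mem_univ, true_and, id] at hw hwmax
    have hvw := hwmax v (π.rel.refl v)
    have hρw : ρ.rel u w := ρ.rel.trans hρuv (hle' hw)
    have hkr : (kreweras π).rel u w := by
      refine NC.rel_kreweras_of_rel hle (huv.le.trans hvw) hρw fun p q hpq hρp hp hpw => ?_
      have hvp : v ≤ p := not_lt.1 fun hlt =>
        absurd (humax p ⟨hlt, ρ.rel.trans (ρ.rel.symm hρp) hρuv⟩) (not_le.2 hp)
      by_cases hvp' : π.rel v p
      · have hvq := π.rel.trans hvp' hpq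
        exact ⟨huv.trans_le (not_lt.1 fun hlt => hmin q hlt (π.rel.symm hvq)), hwmax q hvq⟩
      · have hvp2 : v < p := lt_of_le_of_ne hvp (by rintro rfl; exact hvp' (π.rel.refl _))
        have hpw2 : p < w := lt_of_le_of_ne hpw (by rintro rfl; exact hvp' hw)
        have hvq : ¬ π.rel v q := fun hh => hvp' (π.rel.trans hh (π.rel.symm hpq))
        constructor
        · refine huv.trans_le (not_lt.1 fun hlt => hvp' ?_)
          exact π.rel.trans (π.rel.symm
            (π.rel_noncrossing q v p w hlt hvp2 hpw2 (π.rel.symm hpq) hw)) (π.rel.symm hpq)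
        · exact not_lt.1 fun hlt => hvp' (π.rel_noncrossing v p w q hvp2 hpw2 hlt hw hpq)
    exact τ.trans (hσ (NC.rel_inf.2 ⟨hρw, hkr⟩)) (hπ (π.rel.symm hw))

open Classical in
/-- `(π ∨ σ) ∧ Kr(π) ≤ σ` for `σ ≤ Kr(π)`. -/
theorem NC.sup_inf_kreweras_le {π σ : NC n} (h : σ ≤ kreweras π) :
    (NC.sup h).inf (kreweras π) ≤ σ := by
  have hσρ : σ.rel ≤ ((NC.sup h).inf (kreweras π)).rel := fun i j hij =>
    NC.rel_inf.2 ⟨by rw [NC.rel_sup]; exact (le_sup_right : _ ≤ π.rel ⊔ σ.rel) hij,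
      NC.le_iff.1 h hij⟩
  have hk : ∀ i j, ((NC.sup h).inf (kreweras π)).rel i j →
      (π.rel ⊔ σ.rel) i j ∧ (kreweras π).rel i j := by
    intro i j hij
    rw [← NC.rel_sup h]
    exact NC.rel_inf.1 hij
  generalize (NC.sup h).inf (kreweras π) = κ at *
  suffices H : ∀ v u, u < v → κ.rel u v → σ.rel u v by
    refine NC.le_iff.2 fun i j hij => ?_
    rcases lt_trichotomy i j with h | rfl | h
    · exact H j i h hij
    · exact σ.rel.refl i
    · exact σ.rel.symm (H i j h (κ.rel.symm hij))
  intro v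
  induction v using WellFoundedLT.induction with
  | ind v ih =>
  intro u₀ hu₀ hκ₀
  obtain ⟨u, hu, humax⟩ := exists_max_image (univ.filter fun k => k < v ∧ κ.rel k v) id
    ⟨u₀, by simp [hu₀, hκ₀]⟩
  simp only [mem_filter, mem_univ, true_and, id] at hu humax
  obtain ⟨huv, hκuv⟩ := hu
  suffices huv' : σ.rel u v by
    rcases eq_or_lt_of_le (humax u₀ ⟨hu₀, hκ₀⟩) with rfl | hlt
    · exact huv'
    · exact σ.rel.trans (ih u huv u₀ hlt (κ.rel.trans hκ₀ (κ.rel.symm hκuv))) huv'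
  -- If `u` and `v` are not `σ`-related, induction makes `v` the minimum of its `σ`-block. With `w`
  -- the maximum of that block, the interval from just after `u` up to `w` is closed under `π` and
  -- `σ`. It contains `v` but not `u`, although the join relates them.
  by_contra hne
  obtain ⟨w, hw, hwmax⟩ := exists_max_image (univ.filter fun k => σ.rel v k) id
    ⟨v, by simp⟩
  simp only [mem_filter, mem_univ, true_and, id] at hw hwmax
  have hvw := hwmax v (σ.rel.refl v)
  have hmin : ∀ q, σ.rel v q → v ≤ q := by
    intro q hq
    by_contra! hlt
    have hqu := humax q ⟨hlt, hσρ (σ.rel.symm hq)⟩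
    rcases eq_or_lt_of_le hqu with rfl | hlt'
    · exact hne (σ.rel.symm hq)
    · exact hne (σ.rel.trans (σ.rel.symm
        (ih u huv q hlt' (κ.rel.trans (hσρ (σ.rel.symm hq)) (κ.rel.symm hκuv))))
        (σ.rel.symm hq))
  have hκuw : κ.rel u w := κ.rel.trans hκuv (hσρ hw)
  -- `{u + 1, …, w}` is a union of blocks of `π` and of `σ`
  have key : ∀ p q, σ.rel p q → u < p ∧ p ≤ w → u < q ∧ q ≤ w := by
    rintro p q hpq ⟨hup, hpw⟩
    by_cases hvp : σ.rel v p
    · have hvq := σ.rel.trans hvp hpq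
      exact ⟨huv.trans_le (hmin q hvq), hwmax q hvq⟩
    · have hpw' : p ≠ w := by rintro rfl; exact hvp hw
      have hpw2 := lt_of_le_of_ne hpw hpw'
      by_cases hκp : κ.rel u p
      · have hvp1 : v ≤ p := not_lt.1 fun hlt =>
          absurd (humax p ⟨hlt, κ.rel.trans (κ.rel.symm hκp) hκuv⟩) (not_le.2 hup)
        have hvp2 : v < p := lt_of_le_of_ne hvp1 (by rintro rfl; exact hvp (σ.rel.refl _))
        constructor
        · refine huv.trans_le (not_lt.1 fun hlt => hvp ?_)
          exact σ.rel.trans (σ.rel.symm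
            (σ.rel_noncrossing q v p w hlt hvp2 hpw2 (σ.rel.symm hpq) hw)) (σ.rel.symm hpq)
        · exact not_lt.1 fun hlt => hvp (σ.rel_noncrossing v p w q hvp2 hpw2 hlt hw hpq)
      · have hqu : u ≠ q := by rintro rfl; exact hκp (hσρ (σ.rel.symm hpq))
        constructor
        · refine lt_of_le_of_ne (not_lt.1 fun hlt => hκp ?_) hqu
          exact κ.rel.trans (κ.rel.symm (κ.rel_noncrossing q u p w hlt hup hpw2
            (hσρ (σ.rel.symm hpq)) hκuw)) (hσρ (σ.rel.symm hpq))
        · exact not_lt.1 fun hlt => hκp (κ.rel_noncrossing u p w q hup hpw2 hlt hκuw (hσρ hpq))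
  have hfin := Setoid.sup_closed (S := fun z => u < z ∧ z ≤ w)
    (fun p q hpq hp => NC.mem_Ioc_of_rel_kreweras (hk u w hκuw).2 hpq hp.1 hp.2) key
    ((π.rel ⊔ σ.rel).symm (hk u v hκuv).1) ⟨huv, hvw⟩
  exact lt_irrefl _ hfin.1

open Classical in
/-- The map `ρ ↦ ρ ∧ Kr(π)` is a bijection of `[π, 1]` onto `[0, Kr(π)]`. -/
theorem NC.sum_inf_kreweras (π : NC n) (F : NC n → ℂ) :
    ∑ ρ with π ≤ ρ, F (ρ.inf (kreweras π)) = ∑ σ with σ ≤ kreweras π, F σ := by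
  have hle : ∀ ρ : NC n, ρ.inf (kreweras π) ≤ kreweras π := fun ρ =>
    NC.le_iff.2 fun i j h => (NC.rel_inf.1 h).2
  refine sum_bij (fun ρ _ => ρ.inf (kreweras π)) (fun ρ _ => by simpa using hle ρ) ?_ ?_
    (fun _ _ => rfl)
  · intro ρ hρ ρ' hρ' heq
    simp only [mem_filter, mem_univ, true_and] at hρ hρ'
    -- Injectivity: `ρ` is recovered from its image by joining with `π`.
    have e1 : ∀ ρ : NC n, π ≤ ρ → ρ.rel = π.rel ⊔ (ρ.inf (kreweras π)).rel := fun ρ hρ =>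
      le_antisymm (NC.le_sup_inf_kreweras hρ)
        (sup_le (NC.le_iff.1 hρ) fun i j h => (NC.rel_inf.1 h).1)
    apply NC.rel_injective
    rw [e1 ρ hρ, e1 ρ' hρ']
    exact congrArg (fun σ : NC n => π.rel ⊔ σ.rel) heq
  · intro σ hσ
    simp only [mem_filter, mem_univ, true_and] at hσ
    refine ⟨NC.sup hσ, ?_, le_antisymm (NC.sup_inf_kreweras_le hσ) ?_⟩
    · simp only [mem_filter, mem_univ, true_and, NC.le_iff, NC.rel_sup]
      exact le_sup_left
    · refine NC.le_iff.2 fun i j h => NC.rel_inf.2 ⟨?_, NC.le_iff.1 hσ h⟩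
      rw [NC.rel_sup]
      exact (le_sup_right : _ ≤ π.rel ⊔ σ.rel) h

/-- Blocks of `π` outside `V` lie in single gaps of `V`, so they never separate points of `V`. This
makes the Kreweras complement local to the blocks of `ρ`. -/
theorem NC.comap_inf_kreweras {π ρ : NC n} (hle : π ≤ ρ) (V : ρ.1.parts) :
    (ρ.inf (kreweras π)).comap (ρ.blockEmb V) = kreweras (π.comap (ρ.blockEmb V)) := by
  have key : ∀ a b, a ≤ b → ((kreweras π).rel (ρ.blockEmb V a) (ρ.blockEmb V b) ↔
      (kreweras (π.comap (ρ.blockEmb V))).rel a b) := by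
    intro a b hab
    constructor
    · intro h
      refine NC.rel_kreweras_of_le hab fun p q hpq hap hpb => ?_
      have := NC.mem_Ioc_of_rel_kreweras h (NC.rel_comap.1 hpq)
        ((ρ.blockEmb V).lt_iff_lt.2 hap) ((ρ.blockEmb V).le_iff_le.2 hpb)
      simpa using this
    · intro h
      refine NC.rel_kreweras_of_rel hle ((ρ.blockEmb V).le_iff_le.2 hab) (ρ.rel_blockEmb V a b) ?_
      intro p q hpq hρp hap hpb
      have hp := NC.mem_of_rel V.2 (ρ.blockEmb_mem V a) hρp
      have hq := NC.mem_of_rel V.2 hp (NC.le_iff.1 hle hpq)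
      obtain ⟨p, rfl⟩ := ρ.exists_blockEmb_of_mem V hp
      obtain ⟨q, rfl⟩ := ρ.exists_blockEmb_of_mem V hq
      rw [OrderEmbedding.lt_iff_lt] at hap
      rw [OrderEmbedding.le_iff_le] at hpb
      rw [OrderEmbedding.lt_iff_lt, OrderEmbedding.le_iff_le]
      exact NC.mem_Ioc_of_rel_kreweras h (NC.rel_comap.2 hpq) hap hpb
  refine NC.rel_injective (Setoid.ext fun a b => ?_)
  rw [NC.rel_comap, NC.rel_inf, and_iff_right (ρ.rel_blockEmb V a b)]
  rcases le_total a b with h | h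
  · exact key a b h
  · exact ⟨fun hh => Setoid.symm' _ ((key b a h).1 (Setoid.symm' _ hh)),
      fun hh => Setoid.symm' _ ((key b a h).2 (Setoid.symm' _ hh))⟩

end Lattice

/-! ### The moment-cumulant formula -/

section MomentCumulant

open Finset

variable {n : ℕ} {α : Type*}

theorem blockProd_eq_prod_blockEmb (f : (m : ℕ) → (Fin m → α) → ℂ) (ρ : NC n) (a : Fin n → α) :
    blockProd f ρ a = ∏ V : ρ.1.parts, f V.1.card (a ∘ ρ.blockEmb V) :=
  (Finset.prod_coe_sort ρ.1.parts fun V => f V.card (a ∘ V.orderEmbOfFin rfl)).symm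

theorem NC.card_block_ne_zero {ρ : NC n} {V : Finset (Fin n)} (hV : V ∈ ρ.1.parts) :
    V.card ≠ 0 :=
  Finset.card_ne_zero.2 (ρ.1.nonempty_of_mem_parts hV)

-- Expanding the factor of each block of `ρ` gives a family of partitions of the blocks, which is
-- the same as a refinement of `ρ`.
open Classical in
theorem blockProd_eq_sum_le {M κ : (m : ℕ) → (Fin m → α) → ℂ}
    (h : ∀ m, m ≠ 0 → ∀ a, M m a = ∑ π : NC m, blockProd κ π a) (ρ : NC n) (a : Fin n → α) :
    blockProd M ρ a = ∑ π with π ≤ ρ, blockProd κ π a := by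
  calc blockProd M ρ a
      = ∏ V : ρ.1.parts, ∑ θ, blockProd κ θ (a ∘ ρ.blockEmb V) := by
        rw [blockProd_eq_prod_blockEmb]
        exact prod_congr rfl fun V _ => h _ (NC.card_block_ne_zero V.2) _
    _ = ∑ π with π ≤ ρ, blockProd κ π a := by
        rw [← NC.sum_le_prod_comap]
        refine sum_congr rfl fun π hπ => ?_
        rw [blockProd_eq_prod_parts (by simpa using hπ)]

open Classical in
/-- Families satisfying the moment-cumulant formula are recovered by Möbius inversion. -/
theorem sum_blockProd_mul_moebius {M κ : (m : ℕ) → (Fin m → α) → ℂ}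
    (h : ∀ m, m ≠ 0 → ∀ a, M m a = ∑ π : NC m, blockProd κ π a) (hn : n ≠ 0) (a : Fin n → α) :
    ∑ π : NC n, blockProd M π a * π.moebius = κ n a := by
  calc ∑ π : NC n, blockProd M π a * π.moebius
      = ∑ π : NC n, ∑ θ : NC n, if θ ≤ π then blockProd κ θ a * π.moebius else 0 := by
        refine sum_congr rfl fun π _ => ?_
        rw [blockProd_eq_sum_le h, sum_mul, sum_filter]
    _ = ∑ θ : NC n, blockProd κ θ a * ∑ π ∈ Icc θ (NC.one n), π.moebius := by
        rw [sum_comm]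
        refine sum_congr rfl fun θ _ => ?_
        rw [← sum_filter, mul_sum]
        refine sum_congr ?_ fun _ _ => rfl
        ext π
        simp [NC.le_one]
    -- The inner sum of the Möbius function over `[θ, 1]` vanishes unless `θ = 1`.
    _ = κ n a := by
        simp only [NC.moebius, IncidenceAlgebra.sum_Icc_mu_left]
        simp [blockProd_one κ hn]

open Classical in
/-- The cumulants of `M`, defined by solving the moment-cumulant formula recursively. -/
def recCumulant (M : (m : ℕ) → (Fin m → α) → ℂ) (n : ℕ) (a : Fin n → α) : ℂ :=
  M n a - ∑ π : NC n with π ≠ NC.one n, ∏ V ∈ π.1.parts,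
    -- The guard serves termination only: a block with `n` points forces `π = NC.one n`, so the
    -- value `0` is never used.
    if _h : V.card < n then recCumulant M V.card (a ∘ V.orderEmbOfFin rfl) else 0
termination_by n

theorem eq_sum_recCumulant (M : (m : ℕ) → (Fin m → α) → ℂ) (hn : n ≠ 0) (a : Fin n → α) :
    M n a = ∑ π : NC n, blockProd (recCumulant M) π a := by
  classical
  rw [← sum_filter_add_sum_filter_not univ (fun π => π ≠ NC.one n)]
  simp only [not_not, filter_eq', mem_univ, if_true, sum_singleton]
  rw [blockProd_one _ hn, recCumulant, eq_comm, add_comm, sub_add_eq_add_sub, sub_eq_iff_eq_add,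
    add_right_inj]
  refine sum_congr rfl fun π hπ => prod_congr rfl fun V hV => ?_
  rw [dif_pos]
  refine lt_of_le_of_ne (by simpa using card_le_univ V) fun h => ?_
  exact (mem_filter.1 hπ).2 (NC.eq_one_of_card_eq hV h)

/-- The moment-cumulant formula. -/
theorem eq_sum_blockProd_moebius (M : (m : ℕ) → (Fin m → α) → ℂ) (hn : n ≠ 0) (a : Fin n → α) :
    M n a = ∑ π : NC n, blockProd (fun m b => ∑ σ : NC m, blockProd M σ b * σ.moebius) π a := by
  -- The recursive cumulants satisfy the formula by construction, and inversion identifies them with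
  -- the Möbius sums on every block.
  rw [eq_sum_recCumulant M hn]
  refine sum_congr rfl fun π _ => prod_congr rfl fun V hV => ?_
  exact (sum_blockProd_mul_moebius (fun m hm a => eq_sum_recCumulant M hm a)
    (NC.card_block_ne_zero hV) _).symm

end MomentCumulant

/-! ### Multilinearity and naturality of cumulants -/

section Cumulant

open Finset

variable {n : ℕ} {A : Type*}

/-- The point `i` lies in exactly one block, so a single factor depends on `x`. Multilinearity of
cumulants thereby follows from that of moments. -/
theorem exists_blockProd_update (f : (m : ℕ) → (Fin m → A) → ℂ) (π : NC n) (a : Fin n → A)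
    (i : Fin n) : ∃ (m : ℕ) (b : Fin m → A) (j : Fin m) (c : ℂ),
      ∀ x, blockProd f π (Function.update a i x) = f m (Function.update b j x) * c := by
  obtain ⟨j, hj⟩ : ∃ j, (π.1.part i).orderEmbOfFin rfl j = i :=
    (Set.ext_iff.1 (range_orderEmbOfFin (π.1.part i) rfl) i).2 (NC.mem_part.2 (π.rel.refl i))
  refine ⟨_, a ∘ (π.1.part i).orderEmbOfFin rfl, j,
    ∏ V ∈ π.1.parts.erase (π.1.part i), f V.card (a ∘ V.orderEmbOfFin rfl), fun x => ?_⟩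
  rw [blockProd, ← mul_prod_erase _ _ (π.part_mem i)]
  congr 1
  · rw [← Function.update_comp_eq_of_injective _ (RelEmbedding.injective _), hj]
  · refine prod_congr rfl fun V hV => ?_
    rw [Function.update_comp_eq_of_forall_ne]
    rintro k rfl
    exact (mem_erase.1 hV).1
      (π.1.part_eq_of_mem (mem_erase.1 hV).2 (orderEmbOfFin_mem _ _ _)).symm

variable [Ring A] [Algebra ℂ A]

theorem moment_eq_mkPiAlgebraFin (φ : A →ₗ[ℂ] ℂ) (a : Fin n → A) :
    moment φ n a = φ.compMultilinearMap (MultilinearMap.mkPiAlgebraFin ℂ n A) a := rfl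

/-- The cumulant as a multilinear map. -/
def cumulantMultilinear (φ : A →ₗ[ℂ] ℂ) (n : ℕ) : MultilinearMap ℂ (fun _ : Fin n => A) ℂ where
  toFun := cumulant φ n
  map_update_add' a i x y := by
    -- The field quantifies over all `DecidableEq` instances, whereas `exists_blockProd_update` uses
    -- the canonical one.
    rename_i inst
    rw [Subsingleton.elim inst (instDecidableEqFin n)]
    simp only [cumulant, ← sum_add_distrib]
    refine sum_congr rfl fun π _ => ?_
    obtain ⟨m, b, j, c, h⟩ := exists_blockProd_update (moment φ) π a i
    rw [h, h, h]
    simp only [moment_eq_mkPiAlgebraFin, MultilinearMap.map_update_add]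
    ring
  map_update_smul' a i x y := by
    rename_i inst
    rw [Subsingleton.elim inst (instDecidableEqFin n)]
    simp only [cumulant, smul_sum]
    refine sum_congr rfl fun π _ => ?_
    obtain ⟨m, b, j, c, h⟩ := exists_blockProd_update (moment φ) π a i
    rw [h, h]
    simp only [moment_eq_mkPiAlgebraFin, MultilinearMap.map_update_smul, smul_eq_mul]
    ring

theorem cumulant_add (φ : A →ₗ[ℂ] ℂ) (a b : Fin n → A) :
    cumulant φ n (a + b) = ∑ S : Finset (Fin n), cumulant φ n (S.piecewise a b) :=
  (cumulantMultilinear φ n).map_add_univ a b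

theorem cumulant_comp_algHom {B : Type*} [Ring B] [Algebra ℂ B] (ψ : B →ₗ[ℂ] ℂ) (f : A →ₐ[ℂ] B)
    (a : Fin n → A) : cumulant ψ n (f ∘ a) = cumulant (ψ ∘ₗ f.toLinearMap) n a := by
  have hm : ∀ (m : ℕ) (b : Fin m → A), moment ψ m (f ∘ b) = moment (ψ ∘ₗ f.toLinearMap) m b := by
    intro m b
    simp [moment, map_list_prod, List.map_ofFn]
  refine sum_congr rfl fun π _ => ?_
  congr 1
  exact prod_congr rfl fun V _ => hm _ _

/-! ### Coefficients of series and R-transforms -/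

theorem Theta.ext {s : ℕ} {f g : Theta s} (h : ∀ n, n ≠ 0 → ∀ w, f.1 n w = g.1 n w) : f = g := by
  refine Subtype.ext (funext fun n => ?_)
  rcases eq_or_ne n 0 with rfl | hn
  · exact f.2.trans g.2.symm
  · exact funext (h n hn)

theorem Theta.mk_apply {s : ℕ} (c : (n : ℕ) → (Fin n → Fin s) → ℂ) (hn : n ≠ 0)
    (w : Fin n → Fin s) : (Theta.mk c).1 n w = c n w := if_neg hn

theorem rTransform_apply (φ : A →ₗ[ℂ] ℂ) {s : ℕ} (x : Fin s → A) (hn : n ≠ 0)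
    (w : Fin n → Fin s) : (rTransform φ x).1 n w = cumulant φ n (x ∘ w) := Theta.mk_apply _ hn w

/-- Blocks are nonempty, so the suppressed constant term of the series never enters. -/
theorem blockProd_rTransform (φ : A →ₗ[ℂ] ℂ) {s : ℕ} (x : Fin s → A) (π : NC n)
    (w : Fin n → Fin s) : blockProd (rTransform φ x).1 π w = blockProd (cumulant φ) π (x ∘ w) :=
  prod_congr rfl fun _ hV => rTransform_apply φ x (NC.card_block_ne_zero hV) _

theorem rTransform_comp_algHom {B : Type*} [Ring B] [Algebra ℂ B] (ψ : B →ₗ[ℂ] ℂ) (f : A →ₐ[ℂ] B)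
    {s : ℕ} (x : Fin s → A) : rTransform ψ (f ∘ x) = rTransform (ψ ∘ₗ f.toLinearMap) x :=
  Theta.ext fun n hn w => by
    rw [rTransform_apply _ _ hn, rTransform_apply _ _ hn, Function.comp_assoc,
      cumulant_comp_algHom]

theorem Theta.subst_apply_comp {s t : ℕ} {e : Fin s → Fin t} (he : Function.Injective e)
    (f : Theta s) (hn : n ≠ 0) (v : Fin n → Fin s) :
    (Theta.subst e f).1 n (e ∘ v) = f.1 n v := by
  rw [Theta.subst, Theta.mk_apply _ hn, Fintype.sum_eq_single v, if_pos rfl]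
  exact fun v' hv' => if_neg fun h => hv' (he.comp_left h)

theorem Theta.subst_apply_of_notMem_range {s t : ℕ} {e : Fin s → Fin t} (f : Theta s) (hn : n ≠ 0)
    {w : Fin n → Fin t} {i : Fin n} (hi : w i ∉ Set.range e) : (Theta.subst e f).1 n w = 0 := by
  rw [Theta.subst, Theta.mk_apply _ hn]
  refine sum_eq_zero fun v _ => if_neg ?_
  rintro rfl
  exact hi ⟨v i, rfl⟩

/-! ### Sums of free families -/

theorem FreeSets.cumulant_eq_zero {φ : A →ₗ[ℂ] ℂ} {X Y : Set A} (h : FreeSets φ X Y)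
    {a : Fin n → A} {c : Fin n → Bool} (hX : ∀ i, c i = false → a i ∈ X)
    (hY : ∀ i, c i = true → a i ∈ Y) {i j : Fin n} (hij : c i ≠ c j) : cumulant φ n a = 0 := by
  refine h n a (fun i => if c i then 1 else 0) (fun i => ?_) ⟨i, j, ?_⟩
  · cases hc : c i
    · simpa using Algebra.subset_adjoin (hX i hc)
    · simpa using Algebra.subset_adjoin (hY i hc)
  · cases hi : c i <;> cases hj : c j <;> simp_all

variable {φ : A →ₗ[ℂ] ℂ} {s : ℕ} {x y : Fin s → A}

/-- A nonempty word in one half of the alphabet is seen by one summand only. A word using both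
halves is seen by neither, and its cumulant is mixed. -/
theorem FreeSets.rTransform_append (h : FreeSets φ (Set.range x) (Set.range y)) :
    rTransform φ (Fin.append x y) =
      Theta.subst (Fin.castAdd s) (rTransform φ x) +
        Theta.subst (Fin.natAdd s) (rTransform φ y) := by
  refine Theta.ext fun n hn w => ?_
  have hpos : 0 < n := Nat.pos_of_ne_zero hn
  have hcast : ∀ i : Fin (s + s), (i : ℕ) < s → i ∉ Set.range (Fin.natAdd s : Fin s → _) := by
    rintro _ hi ⟨j, rfl⟩
    simp at hi
  have hnat : ∀ i : Fin (s + s), ¬ (i : ℕ) < s →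
      i ∉ Set.range (Fin.castAdd s : Fin s → Fin (s + s)) := by
    rintro _ hi ⟨j, rfl⟩
    simp at hi
  change _ = (Theta.subst _ _).1 n w + (Theta.subst _ _).1 n w
  rw [rTransform_apply _ _ hn]
  by_cases hall : ∀ i, (w i : ℕ) < s
  · obtain ⟨v, rfl⟩ : ∃ v : Fin n → Fin s, Fin.castAdd s ∘ v = w :=
      ⟨fun i => ⟨w i, hall i⟩, by ext; rfl⟩
    rw [Theta.subst_apply_comp (Fin.castAdd_injective s s) _ hn,
      Theta.subst_apply_of_notMem_range _ hn (hcast _ (hall ⟨0, hpos⟩)), add_zero,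
      rTransform_apply _ _ hn, ← Function.comp_assoc]
    exact congrArg (fun z => cumulant φ n (z ∘ v)) (funext fun i => Fin.append_left x y i)
  by_cases hall' : ∀ i, ¬ (w i : ℕ) < s
  · obtain ⟨v, rfl⟩ : ∃ v : Fin n → Fin s, Fin.natAdd s ∘ v = w :=
      ⟨fun i => ⟨w i - s, by have := hall' i; omega⟩, by
        ext i
        have := hall' i
        simp
        omega⟩
    rw [Theta.subst_apply_comp (Fin.natAdd_injective s s) _ hn,
      Theta.subst_apply_of_notMem_range _ hn (hnat _ (hall' ⟨0, hpos⟩)), zero_add,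
      rTransform_apply _ _ hn, ← Function.comp_assoc]
    exact congrArg (fun z => cumulant φ n (z ∘ v)) (funext fun i => Fin.append_right x y i)
  · push Not at hall hall'
    obtain ⟨i, hi⟩ := hall
    obtain ⟨j, hj⟩ := hall'
    rw [Theta.subst_apply_of_notMem_range _ hn (hnat _ (not_lt.2 hi)),
      Theta.subst_apply_of_notMem_range _ hn (hcast _ hj), add_zero]
    refine h.cumulant_eq_zero (c := fun i => decide (s ≤ w i)) (i := i) (j := j) ?_ ?_ ?_
    · intro k hk
      have hk' : (w k : ℕ) < s := by simpa using hk
      exact ⟨⟨w k, hk'⟩, by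
        rw [← Fin.append_left x y]; rfl⟩
    · intro k hk
      have hk' : s ≤ (w k : ℕ) := by simpa using hk
      refine ⟨⟨w k - s, by omega⟩, ?_⟩
      rw [← Fin.append_right x y]
      simp only [Function.comp]
      congr 1
      ext
      simp
      omega
    · simp [hi, hj]

theorem FreeSets.rTransform_add (h : FreeSets φ (Set.range x) (Set.range y)) :
    rTransform φ (x + y) = rTransform φ x + rTransform φ y := by
  refine Theta.ext fun n hn w => ?_
  have : Nonempty (Fin n) := Fin.pos_iff_nonempty.1 (Nat.pos_of_ne_zero hn)
  change _ = (rTransform φ x).1 n w + (rTransform φ y).1 n w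
  rw [rTransform_apply _ _ hn, rTransform_apply _ _ hn, rTransform_apply _ _ hn]
  change cumulant φ n (x ∘ w + y ∘ w) = _
  -- Every other `S` chooses some letters from `x` and some from `y`, giving a mixed cumulant. The
  -- two surviving subsets are distinct because `n ≠ 0`.
  rw [cumulant_add, Fintype.sum_eq_add univ ∅ univ_nonempty.ne_empty, piecewise_univ,
    piecewise_empty]
  rintro S ⟨hS, hS'⟩
  obtain ⟨i, hi⟩ := nonempty_iff_ne_empty.2 hS'
  obtain ⟨j, hj⟩ : ∃ j, j ∉ S := by
    by_contra! hc
    exact hS (eq_univ_of_forall hc)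
  refine h.cumulant_eq_zero (c := fun i => decide (i ∉ S)) (i := i) (j := j) ?_ ?_ ?_
  · intro k hk
    have hk' : k ∈ S := by simpa using hk
    simp [hk']
  · intro k hk
    have hk' : k ∉ S := by simpa using hk
    simp [hk']
  · simp [hi, hj]

end Cumulant

/-! ### Products of free families -/

section Product

open Finset

variable {n : ℕ}

open Classical in
/-- Summation over the noncrossing partitions of the blocks of noncrossing partitions: the
combinatorial content of the boxed convolution. -/
theorem sum_blockProd_boxedConv {α : Type*} (f g : (m : ℕ) → (Fin m → α) → ℂ) (a : Fin n → α) :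
    ∑ ρ : NC n, blockProd
        (fun _ b => ∑ π, blockProd f π b * blockProd g (kreweras π) b) ρ a =
      ∑ π : NC n, ∑ σ with σ ≤ kreweras π, blockProd f π a * blockProd g σ a := by
  calc _ = ∑ ρ : NC n, ∑ π : NC n,
          if π ≤ ρ then blockProd f π a * blockProd g (ρ.inf (kreweras π)) a else 0 := by
        refine sum_congr rfl fun ρ _ => ?_
        rw [blockProd_eq_prod_blockEmb, ← NC.sum_le_prod_comap ρ (fun V θ =>
          blockProd f θ (a ∘ ρ.blockEmb V) * blockProd g (kreweras θ) (a ∘ ρ.blockEmb V)),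
          ← sum_filter]
        refine sum_congr rfl fun π hπ => ?_
        have hle : π ≤ ρ := by simpa using hπ
        have hle' : ρ.inf (kreweras π) ≤ ρ := NC.le_iff.2 fun i j h => (NC.rel_inf.1 h).1
        rw [prod_mul_distrib, blockProd_eq_prod_parts hle, blockProd_eq_prod_parts hle']
        simp only [NC.comap_inf_kreweras hle]
    _ = _ := by
        rw [sum_comm]
        refine sum_congr rfl fun π _ => ?_
        rw [← sum_filter, ← NC.sum_inf_kreweras]

/-- The embedding of `Fin n` as the even (`false`) or odd (`true`) points. -/
def parityEmb (n : ℕ) (b : Bool) : Fin n ↪o Fin (n * 2) :=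
  OrderEmbedding.ofStrictMono (fun i => ⟨i * 2 + b.toNat, by have := b.toNat_lt; omega⟩)
    fun i j h => by
      have : (i : ℕ) < j := h
      simp only [Fin.mk_lt_mk]
      omega

theorem parityEmb_val (b : Bool) (i : Fin n) : (parityEmb n b i : ℕ) = i * 2 + b.toNat := rfl

theorem exists_parityEmb (i : Fin (n * 2)) : ∃ b j, parityEmb n b j = i := by
  rcases Nat.mod_two_eq_zero_or_one i with h | h
  · exact ⟨false, ⟨i / 2, by omega⟩, Fin.ext (by simp [parityEmb_val]; omega)⟩
  · exact ⟨true, ⟨i / 2, by omega⟩, Fin.ext (by simp [parityEmb_val]; omega)⟩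

theorem eq_of_parityEmb_eq (b b' : Bool) (i j : Fin n) (h : parityEmb n b i = parityEmb n b' j) :
    b = b' := by
  have := congrArg Fin.val h
  simp only [parityEmb_val] at this
  cases b <;> cases b' <;> simp at this ⊢ <;> omega

/-- `π` on the even points together with `σ` on the odd points. -/
abbrev NC.parityGlue (π σ : NC n) : Setoid (Fin (n * 2)) :=
  NC.glue (l := fun _ => n) exists_parityEmb eq_of_parityEmb_eq
    (fun b : Bool => if b then σ else π)

/-- A crossing of equal parity contradicts `π` or `σ`. One of opposite parities is a block of `π`
leaving an interval that `Kr(π)` requires to be closed. -/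
theorem NC.parityGlue_noncrossing {π σ : NC n} (h : σ ≤ kreweras π) :
    IsNoncrossing fun i j => NC.parityGlue π σ i j := by
  have hk := NC.le_iff.1 h
  rintro _ _ _ _ hab hbc hcd ⟨b, i, k, rfl, rfl, hik⟩ ⟨b', j, l, rfl, rfl, hjl⟩
  simp only [Fin.lt_def, parityEmb_val] at hab hbc hcd
  cases b <;> cases b' <;> simp at hab hbc hcd hik hjl
  · exact NC.glue_apply.2 (π.rel_noncrossing i j k l hab hbc hcd hik hjl)
  · have := NC.mem_Ioc_of_rel_kreweras (hk hjl) (π.rel.symm hik) (Fin.lt_def.2 (by omega))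
      (Fin.le_def.2 (by omega))
    simp only [Fin.lt_def, Fin.le_def] at this
    omega
  · have := NC.mem_Ioc_of_rel_kreweras (hk hik) hjl (Fin.lt_def.2 (by omega))
      (Fin.le_def.2 (by omega))
    simp only [Fin.lt_def, Fin.le_def] at this
    omega
  · exact NC.glue_apply.2 (σ.rel_noncrossing i j k l hab hbc hcd hik hjl)

theorem NC.comap_parityEmb_le_kreweras {τ : NC (n * 2)}
    (h : ∀ b b' i j, τ.rel (parityEmb n b i) (parityEmb n b' j) → b = b') :
    τ.comap (parityEmb n true) ≤ kreweras (τ.comap (parityEmb n false)) := by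
  have key : ∀ i j, i ≤ j → (τ.comap (parityEmb n true)).rel i j →
      (kreweras (τ.comap (parityEmb n false))).rel i j := by
    intro i j hij hrel
    refine NC.rel_kreweras_of_le hij fun p q hpq hip hpj => ?_
    rw [NC.rel_comap] at hrel hpq
    simp only [Fin.lt_def, Fin.le_def] at hip hpj
    by_contra hq
    simp only [Fin.lt_def, Fin.le_def] at hq
    rcases lt_or_ge (i : ℕ) q with hlt | hge
    · have := h _ _ _ _ (τ.rel_noncrossing _ _ _ _
        (Fin.lt_def.2 (by simp [parityEmb_val]; omega))
        (Fin.lt_def.2 (by simp [parityEmb_val]; omega))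
        (Fin.lt_def.2 (by simp [parityEmb_val]; omega)) hrel hpq)
      simp at this
    · have := h _ _ _ _ (τ.rel_noncrossing _ _ _ _
        (Fin.lt_def.2 (by simp [parityEmb_val]; omega))
        (Fin.lt_def.2 (by simp [parityEmb_val]; omega))
        (Fin.lt_def.2 (by simp [parityEmb_val]; omega)) (τ.rel.symm hpq) hrel)
      simp at this
  refine NC.le_iff.2 fun i j hij => ?_
  rcases le_total i j with h | h
  · exact key i j h hij
  · exact Setoid.symm' _ (key j i h (Setoid.symm' _ hij))

open Classical in
/-- The noncrossing partitions of `Fin (n * 2)` whose blocks consist of points of equal parity are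
the pairs `(π, σ)` with `σ ≤ Kr(π)`. -/
theorem NC.sum_parity (F : NC n → NC n → ℂ) :
    ∑ τ : NC (n * 2) with ∀ b b' i j, τ.rel (parityEmb n b i) (parityEmb n b' j) → b = b',
        F (τ.comap (parityEmb n false)) (τ.comap (parityEmb n true)) =
      ∑ π : NC n, ∑ σ with σ ≤ kreweras π, F π σ := by
  rw [sum_sigma']
  refine sum_bij' (fun τ _ => ⟨τ.comap (parityEmb n false), τ.comap (parityEmb n true)⟩)
    (fun p hp => NC.ofRel _ (NC.parityGlue_noncrossing (by simpa using hp) :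
      IsNoncrossing fun i j => NC.parityGlue p.1 p.2 i j)) ?_ ?_ ?_ ?_ ?_
  · intro τ hτ
    simpa using NC.comap_parityEmb_le_kreweras (by simpa using hτ)
  · rintro ⟨π, σ⟩ hp
    refine mem_filter.2 ⟨mem_univ _, fun b b' i j hij => ?_⟩
    rw [NC.rel_ofRel] at hij
    exact NC.eq_of_glue hij
  · intro τ hτ
    have hτ' : ∀ b b' i j, τ.rel (parityEmb n b i) (parityEmb n b' j) → b = b' := by
      simpa using hτ
    refine NC.rel_injective (Setoid.ext fun i j => ?_)
    rw [NC.rel_ofRel]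
    obtain ⟨b, i, rfl⟩ := exists_parityEmb i
    obtain ⟨b', j, rfl⟩ := exists_parityEmb j
    constructor
    · intro hij
      obtain rfl : b = b' := NC.eq_of_glue hij
      have := NC.glue_apply.1 hij
      cases b <;> exact NC.rel_comap.1 this
    · intro hij
      obtain rfl := hτ' _ _ _ _ hij
      refine NC.glue_apply.2 ?_
      cases b <;> exact NC.rel_comap.2 hij
  · rintro ⟨π, σ⟩ hp
    have h := NC.parityGlue_noncrossing (π := π) (σ := σ) (by simpa using hp)
    have h1 := NC.comap_ofRel_glue h false
    have h2 := NC.comap_ofRel_glue h true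
    simp only [if_true, Bool.false_eq_true, if_false] at h1 h2
    dsimp only
    rw [h1, h2]
  · intros; rfl

variable {A : Type*}

/-- The word `x_1 y_1 x_2 y_2 ⋯`. -/
def alternate (x y : Fin n → A) (i : Fin (n * 2)) : A :=
  if (i : ℕ) % 2 = 0 then x ⟨i / 2, by omega⟩ else y ⟨i / 2, by omega⟩

theorem alternate_parityEmb_false (x y : Fin n → A) : alternate x y ∘ parityEmb n false = x := by
  ext i
  simp [alternate, parityEmb_val]

theorem alternate_parityEmb_true (x y : Fin n → A) : alternate x y ∘ parityEmb n true = y := by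
  ext i
  have h2 : ((i : ℕ) * 2 + 1) / 2 = i := by omega
  simp [alternate, parityEmb_val, h2]

variable [Ring A] [Algebra ℂ A] {φ : A →ₗ[ℂ] ℂ} {s : ℕ} {x y : Fin s → A}

theorem moment_alternate (φ : A →ₗ[ℂ] ℂ) (x y : Fin n → A) :
    moment φ (n * 2) (alternate x y) = moment φ n (x * y) := by
  -- A word of length `n * 2` is read as `n` consecutive pairs.
  rw [moment, moment, List.ofFn_mul, List.prod_flatten, List.map_ofFn]
  congr 3
  ext i
  have h2 : ((i : ℕ) * 2 + 1) / 2 = i := by omega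
  simp [alternate, h2]

-- The moment-cumulant formula is applied to the alternating word of length `n * 2`; freeness leaves
-- only the partitions that respect parity.
open Classical in
theorem FreeSets.moment_mul {X Y : Set A} (h : FreeSets φ X Y) (hn : n ≠ 0) {x y : Fin n → A}
    (hx : ∀ i, x i ∈ X) (hy : ∀ i, y i ∈ Y) :
    moment φ n (x * y) = ∑ π : NC n, ∑ σ with σ ≤ kreweras π,
      blockProd (cumulant φ) π x * blockProd (cumulant φ) σ y := by
  rw [← moment_alternate, eq_sum_blockProd_moebius (moment φ) (by omega), ← NC.sum_parity,
    sum_filter]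
  refine sum_congr rfl fun τ _ => ?_
  change blockProd (cumulant φ) τ _ = _
  split_ifs with hτ
  · rw [blockProd_eq_prod_comap exists_parityEmb hτ, Fintype.prod_bool,
      alternate_parityEmb_false, alternate_parityEmb_true, mul_comm]
  -- Some block contains points of both parities, so its factor is a mixed cumulant and the whole
  -- product vanishes.
  · push Not at hτ
    obtain ⟨b, b', i, j, hrel, hne⟩ := hτ
    refine prod_eq_zero (τ.part_mem (parityEmb n b i)) ?_
    set V := τ.1.part (parityEmb n b i)
    have hi : parityEmb n b i ∈ Set.range (V.orderEmbOfFin rfl) := by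
      rw [range_orderEmbOfFin]; exact NC.mem_part.2 (τ.rel.refl _)
    have hj : parityEmb n b' j ∈ Set.range (V.orderEmbOfFin rfl) := by
      rw [range_orderEmbOfFin]; exact NC.mem_part.2 (τ.rel.symm hrel)
    obtain ⟨i', hi'⟩ := hi
    obtain ⟨j', hj'⟩ := hj
    refine h.cumulant_eq_zero
      (c := fun k => decide ((V.orderEmbOfFin rfl k : ℕ) % 2 ≠ 0)) (i := i') (j := j') ?_ ?_ ?_
    · intro k hk
      have hk' : (V.orderEmbOfFin rfl k : ℕ) % 2 = 0 := by simpa using hk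
      simp only [Function.comp, alternate, hk', if_true]
      exact hx _
    · intro k hk
      have hk' : (V.orderEmbOfFin rfl k : ℕ) % 2 ≠ 0 := by simpa using hk
      simp only [Function.comp, alternate, hk', if_false]
      exact hy _
    · rw [hi', hj']
      cases b <;> cases b' <;> simp_all [parityEmb_val]

theorem FreeSets.rTransform_mul (h : FreeSets φ (Set.range x) (Set.range y)) :
    rTransform φ (x * y) = Theta.boxedConv (rTransform φ x) (rTransform φ y) := by
  classical
  refine Theta.ext fun n hn w => ?_
  rw [rTransform_apply _ _ hn, Theta.boxedConv, Theta.mk_apply _ hn]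
  -- The families are indexed by words in the letters `Fin s`. It suffices that the boxed
  -- coefficients satisfy the moment-cumulant formula for the products, since inversion determines
  -- them.
  refine sum_blockProd_mul_moebius (M := fun m v => moment φ m ((x * y) ∘ v))
    (κ := fun _ v => ∑ π, blockProd (rTransform φ x).1 π v *
      blockProd (rTransform φ y).1 (kreweras π) v) (fun m hm v => ?_) hn w
  rw [sum_blockProd_boxedConv]
  simp only [blockProd_rTransform]
  exact h.moment_mul hm (x := x ∘ v) (y := y ∘ v) (fun i => ⟨_, rfl⟩) (fun i => ⟨_, rfl⟩)

end Product

theorem comp_append {α β : Type*} {m n : ℕ} (f : α → β) (x : Fin m → α) (y : Fin n → α) :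
    f ∘ Fin.append x y = Fin.append (f ∘ x) (f ∘ y) :=
  funext fun i => Fin.addCases (fun i => by simp) (fun i => by simp) i

/-! ### The tower -/

namespace NCPTower

variable {𝒜 : Type*} [Ring 𝒜] [Algebra ℂ 𝒜] (T : NCPTower 𝒜) {s m n : ℕ}

theorem alg_le_envAlg (p : ℕ) : T.alg p ≤ T.envAlg := fun _ ha => T.mem_envAlg.2 ⟨p, ha⟩

theorem envE_comp_inclusion (p : ℕ) :
    T.envE ∘ₗ (Subalgebra.inclusion (T.alg_le_envAlg p)).toLinearMap = T.E p :=
  LinearMap.ext fun a => T.envFun_eq _ p a.2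

theorem rTransform_inclusion (p : ℕ) (x : Fin s → T.alg p) :
    rTransform T.envE (Subalgebra.inclusion (T.alg_le_envAlg p) ∘ x) = rTransform (T.E p) x := by
  rw [rTransform_comp_algHom, envE_comp_inclusion]

end NCPTower

theorem mainTheorem1 {𝒜 : Type*} [Ring 𝒜] [Algebra ℂ 𝒜] (T : NCPTower 𝒜) (s k l : ℕ)
    (hkl : k < l) (x y : Fin s → 𝒜)
    (hx : ∀ i, x i ∈ T.levels 1 k) (hy : ∀ i, y i ∈ T.levels (k + 1) l)
    (hfree : FreeSets (T.E l) (Set.range (T.toAlg x hx l hkl.le))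
      (Set.range (T.toAlg y hy l le_rfl))) :
    (rTransform T.envE (Fin.append (T.toEnv x hx) (T.toEnv y hy)) =
        Theta.subst (Fin.castAdd s) (rTransform T.envE (T.toEnv x hx)) +
          Theta.subst (Fin.natAdd s) (rTransform T.envE (T.toEnv y hy)) ∧
      rTransform T.envE (T.toEnv x hx + T.toEnv y hy) =
        rTransform T.envE (T.toEnv x hx) + rTransform T.envE (T.toEnv y hy) ∧
      rTransform T.envE (T.toEnv x hx * T.toEnv y hy) =
        Theta.boxedConv (rTransform T.envE (T.toEnv x hx)) (rTransform T.envE (T.toEnv y hy))) ∧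
    (rTransform T.envE (Fin.append (T.toEnv x hx) (T.toEnv y hy)) =
        Theta.subst (Fin.castAdd s) (rTransform (T.E k) (T.toAlg x hx k le_rfl)) +
          Theta.subst (Fin.natAdd s) (rTransform (T.E l) (T.toAlg y hy l le_rfl)) ∧
      rTransform T.envE (T.toEnv x hx + T.toEnv y hy) =
        rTransform (T.E k) (T.toAlg x hx k le_rfl) +
          rTransform (T.E l) (T.toAlg y hy l le_rfl) ∧
      rTransform T.envE (T.toEnv x hx * T.toEnv y hy) =
        Theta.boxedConv (rTransform (T.E k) (T.toAlg x hx k le_rfl))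
          (rTransform (T.E l) (T.toAlg y hy l le_rfl))) := by
  have ex : T.toEnv x hx = Subalgebra.inclusion (T.alg_le_envAlg l) ∘ T.toAlg x hx l hkl.le := rfl
  have ey : T.toEnv y hy = Subalgebra.inclusion (T.alg_le_envAlg l) ∘ T.toAlg y hy l le_rfl := rfl
  have ex' : T.toEnv x hx = Subalgebra.inclusion (T.alg_le_envAlg k) ∘ T.toAlg x hx k le_rfl := rfl
  have rx' : rTransform T.envE (T.toEnv x hx) = rTransform (T.E k) (T.toAlg x hx k le_rfl) := by
    rw [ex', T.rTransform_inclusion]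
  have rx : rTransform T.envE (T.toEnv x hx) = rTransform (T.E l) (T.toAlg x hx l hkl.le) := by
    rw [ex, T.rTransform_inclusion]
  have ry : rTransform T.envE (T.toEnv y hy) = rTransform (T.E l) (T.toAlg y hy l le_rfl) := by
    rw [ey, T.rTransform_inclusion]
  have happ : rTransform T.envE (Fin.append (T.toEnv x hx) (T.toEnv y hy)) =
      rTransform (T.E l) (Fin.append (T.toAlg x hx l hkl.le) (T.toAlg y hy l le_rfl)) := by
    rw [ex, ey, ← comp_append, T.rTransform_inclusion]
  have hadd : rTransform T.envE (T.toEnv x hx + T.toEnv y hy) =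
      rTransform (T.E l) (T.toAlg x hx l hkl.le + T.toAlg y hy l le_rfl) := by
    rw [← T.rTransform_inclusion]; rfl
  have hmul : rTransform T.envE (T.toEnv x hx * T.toEnv y hy) =
      rTransform (T.E l) (T.toAlg x hx l hkl.le * T.toAlg y hy l le_rfl) := by
    rw [← T.rTransform_inclusion]; rfl
  -- The R-transform of `x` is the same over `E k`, `E l` and `envE`, so both triples become one
  -- triple about free families in `(T.alg l, T.E l)`.
  rw [← rx', ← ry, happ, hadd, hmul, rx, ry]
  have main := And.intro hfree.rTransform_append
    (And.intro hfree.rTransform_add hfree.rTransform_mul)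
  exact ⟨main, main⟩

end
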